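/- For each $p\ge 1$ let $\mathbf y_p$ be a random vector in $\mathbb R^p$ and let $\Sigma_p$ be a random real symmetric positive semi-definite $p\times p$ matrix defined on the same probability space as $\mathbf y_p$. Assume: (A1) $\big(\mathbf y_p^\top A_p\mathbf y_p-\operatorname{tr}(\Sigma_pA_p)\big)/p\to 0$ in probability as $p\to\infty$, for every sequence of (deterministic) real symmetric positive semi-definite $p\times p$ matrices $A_p$ with uniformly bounded spectral norms; (A2) $\operatorname{tr}(\Sigma_p^2)/p^2\to 0$ in probability as $p\to\infty$. Let $\mathbf w_p$ be a standard normal vector in $\mathbb R^p$ independent of $\Sigma_p$, and let $\mathbf z_p=\Sigma_p^{1/2}\mathbf w_p$, where $\Sigma_p^{1/2}$ is the principal (positive semi-definite) square root. Let $p=p(n)$ be such that $p/n\to y$ as $n\to\infty$ for some $y>0$. For each $n\ge 1$, let $\mathbf Y_{pn}$ and $\mathbf Z_{pn}$ be random $p\times n$ matrices, all defined on one probability space, such that the columns of $\mathbf Y_{pn}$ are independent copies of $\mathbf y_p$ and the columns of $\mathbf Z_{pn}$ are independent copies of $\mathbf z_p$ (no assumption is made on the joint distribution of $\mathbf Y_{pn}$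 and $\mathbf Z_{pn}$, or of these matrices for different $n$). Then, for every $z\in\mathbb C$ with $\operatorname{Im} z>0$, $$p^{-1}\operatorname{tr}\big(n^{-1}\mathbf Y_{pn}\mathbf Y_{pn}^\top-zI_p\big)^{-1}-p^{-1}\operatorname{tr}\big(n^{-1}\mathbf Z_{pn}\mathbf Z_{pn}^\top-zI_p\big)^{-1}\to 0\quad\text{almost surely as } n\to\infty .$$ -/

import Mathlib

open MeasureTheory ProbabilityTheory Filter Topology Matrix
open scoped MatrixOrder

/-- The entrywise (product, equivalently Borel) measurable structure on real matrices. -/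
instance instMeasurableSpaceRealMatrix {m n : ℕ} :
    MeasurableSpace (Matrix (Fin m) (Fin n) ℝ) :=
  inferInstanceAs (MeasurableSpace (Fin m → Fin n → ℝ))

/-- Spectral norm of a real square matrix: its operator norm for the Euclidean norm. -/
noncomputable def matrixSpectralNorm {p : ℕ} (A : Matrix (Fin p) (Fin p) ℝ) : ℝ :=
  ‖Matrix.toEuclideanCLM (n := Fin p) (𝕜 := ℝ) A‖

/-- Weak law of large numbers for quadratic forms: `(yₚᵀ Aₚ yₚ - tr (Σₚ Aₚ)) / p → 0` in
probability, for every sequence of real symmetric positive semi-definite `p × p` matrices `Aₚ`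
with uniformly bounded spectral norms. -/
def QuadraticFormWLLN {Ω₀ : Type*} [MeasurableSpace Ω₀] (P₀ : Measure Ω₀)
    (y : (p : ℕ) → Ω₀ → (Fin p → ℝ))
    (S : (p : ℕ) → Ω₀ → Matrix (Fin p) (Fin p) ℝ) : Prop :=
  ∀ A : (p : ℕ) → Matrix (Fin p) (Fin p) ℝ,
    (∀ p, (A p).PosSemidef) → (∃ M : ℝ, ∀ p, matrixSpectralNorm (A p) ≤ M) →
    TendstoInMeasure P₀
      (fun (p : ℕ) (ω : Ω₀) =>
        (y p ω ⬝ᵥ (A p *ᵥ y p ω) - Matrix.trace (S p ω * A p)) / (p : ℝ))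
      atTop (fun _ => 0)

/-- `tr (Σₚ²) / p² → 0` in probability. -/
def TraceSqNegligible {Ω₀ : Type*} [MeasurableSpace Ω₀] (P₀ : Measure Ω₀)
    (S : (p : ℕ) → Ω₀ → Matrix (Fin p) (Fin p) ℝ) : Prop :=
  TendstoInMeasure P₀
    (fun (p : ℕ) (ω : Ω₀) => Matrix.trace (S p ω ^ 2) / (p : ℝ) ^ 2)
    atTop (fun _ => 0)

/-- The columns of the random matrix `X` are independent copies of the random vector `x`
(which may live on another probability space). -/
def ColumnsAreIndepCopies {Ω Ω₀ : Type*} [MeasurableSpace Ω] [MeasurableSpace Ω₀] {p n : ℕ}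
    (X : Ω → Matrix (Fin p) (Fin n) ℝ) (P : Measure Ω)
    (x : Ω₀ → (Fin p → ℝ)) (P₀ : Measure Ω₀) : Prop :=
  iIndepFun (fun (k : Fin n) (ω : Ω) (i : Fin p) => X ω i k) P ∧
    ∀ k : Fin n, IdentDistrib (fun (ω : Ω) (i : Fin p) => X ω i k) x P P₀

/-- Sample covariance matrix `n⁻¹ X Xᵀ`. -/
noncomputable def sampleCov {p n : ℕ} (X : Matrix (Fin p) (Fin n) ℝ) :
    Matrix (Fin p) (Fin p) ℝ :=
  (n : ℝ)⁻¹ • (X * Xᵀ)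

/-- Stieltjes transform `p⁻¹ tr (A - z Iₚ)⁻¹` of the empirical spectral distribution of `A`. -/
noncomputable def stieltjesESD {p : ℕ} (A : Matrix (Fin p) (Fin p) ℝ) (z : ℂ) : ℂ :=
  (p : ℂ)⁻¹ * Matrix.trace ((A.map (fun a : ℝ => (a : ℂ)) - z • (1 : Matrix (Fin p) (Fin p) ℂ))⁻¹)

/-! View the Stieltjes transform as a bounded function of the `n` independent columns. It suffices
that it concentrates around its mean almost surely, and that the means for `Y` and `Z` differ by
`o(1)`.

Concentration: changing one column moves the transform by at most `2 / (p Im z)`, whatever the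
columns are, since each column enters as a rank-one perturbation. McDiarmid's inequality
(`hasSubgaussianMGF_pi_of_bounded_differences`) then has variance proxy `O(1/n)`, and Borel–Cantelli
applies. Only the law for each single `n` enters, so couplings play no role.

Means: the columns are exchanged one at a time, as in Lindeberg's method
(`norm_integral_pi_sub_le`). With the other columns frozen, Sherman–Morrison writes the effect of a
column as `-p⁻¹` times `rankOneShift`, a quotient whose numerator and denominator are affine in the
squared coordinates of the column in an eigenbasis of the leave-one-out matrix. This quotient is
bounded by `1 / Im z` and is stable under small changes of the two linear statistics involved. By
(A1) these quadratic forms may be replaced by traces against `Σ`, which leaves a quantity depending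
on `Σ` alone (`QuadraticFormWLLN.norm_integral_rankOneShift_sub_le`).

The Gaussian mixture `Σ^{1/2} w` obeys (A1) with the same `Σ`, by Chebyshev conditionally on `Σ` and
(A2) (`quadraticFormWLLN_gaussian_mixture`). Both kinds of column are thus compared with the same
quantity, a swap costs `o(1/p)`, and `n` swaps cost `o(1)`. The leave-one-out matrix is arbitrary,
so (A1) is needed uniformly over matrices; a worst-case sequence provides this
(`QuadraticFormWLLN.uniform`). -/

instance instBorelSpaceRealMatrix {m n : ℕ} : BorelSpace (Matrix (Fin m) (Fin n) ℝ) :=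
  inferInstanceAs (BorelSpace (Fin m → Fin n → ℝ))

/-! ### Resolvents under rank-one perturbations -/

section Deterministic

/-- Trace form of the Sherman–Morrison formula for a symmetric rank-one update. -/
theorem trace_inv_add_smul_vecMulVec {ι : Type*} [Fintype ι] [DecidableEq ι]
    (M R : Matrix ι ι ℂ) (hMR : M * R = 1) (hR : Rᵀ = R) (u : ι → ℂ) (c : ℂ)
    (h : 1 + c * (u ⬝ᵥ R *ᵥ u) ≠ 0) :
    trace ((M + c • vecMulVec u u)⁻¹) =
      trace R - c * (R *ᵥ u ⬝ᵥ R *ᵥ u) / (1 + c * (u ⬝ᵥ R *ᵥ u)) := by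
  set a := u ⬝ᵥ R *ᵥ u with ha
  have hinv : (M + c • vecMulVec u u)⁻¹ =
      R - (c / (1 + c * a)) • vecMulVec (R *ᵥ u) (R *ᵥ u) := by
    apply Matrix.inv_eq_right_inv
    have h1 : M * vecMulVec (R *ᵥ u) (R *ᵥ u) = vecMulVec u (R *ᵥ u) := by
      rw [mul_vecMulVec, mulVec_mulVec, hMR, one_mulVec]
    have h2 : vecMulVec u u * R = vecMulVec u (R *ᵥ u) := by
      rw [vecMulVec_mul, ← mulVec_transpose, hR]
    have h3 : vecMulVec u u * vecMulVec (R *ᵥ u) (R *ᵥ u) = a • vecMulVec u (R *ᵥ u) := by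
      rw [vecMulVec_mul_vecMulVec, ← ha]
      ext i j; simp [vecMulVec_apply]; ring
    rw [add_mul, mul_sub, mul_sub, hMR, Matrix.mul_smul, Matrix.smul_mul, Matrix.smul_mul,
      Matrix.mul_smul, h1, h2, h3, smul_smul, smul_smul]
    ext i j
    simp only [Matrix.add_apply, Matrix.sub_apply, Matrix.smul_apply, smul_eq_mul]
    field_simp
    ring
  rw [hinv, trace_sub, trace_smul, trace_vecMulVec, smul_eq_mul]
  ring

theorem exists_orthogonal_diagonalization {ι : Type*} [Fintype ι] [DecidableEq ι]
    {B : Matrix ι ι ℝ} (hB : B.IsHermitian) :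
    ∃ U : Matrix ι ι ℝ, U * Uᵀ = 1 ∧ Uᵀ * U = 1 ∧
      B = U * diagonal hB.eigenvalues * Uᵀ := by
  refine ⟨hB.eigenvectorUnitary, ?_, ?_, ?_⟩
  · exact Unitary.mul_star_self_of_mem hB.eigenvectorUnitary.2
  · exact Unitary.star_mul_self_of_mem hB.eigenvectorUnitary.2
  · conv_lhs => rw [hB.spectral_theorem]
    rw [Unitary.conjStarAlgAut_apply]
    rfl

theorem Matrix.PosSemidef.exists_orthogonal_diagonalization {ι : Type*} [Fintype ι]
    [DecidableEq ι] {B : Matrix ι ι ℝ} (hB : B.PosSemidef) :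
    ∃ (U : Matrix ι ι ℝ) (l : ι → ℝ), U * Uᵀ = 1 ∧ Uᵀ * U = 1 ∧ (∀ i, 0 ≤ l i) ∧
      B = U * diagonal l * Uᵀ := by
  obtain ⟨U, h1, h2, h3⟩ := _root_.exists_orthogonal_diagonalization hB.1
  exact ⟨U, _, h1, h2, hB.eigenvalues_nonneg, h3⟩

theorem resolvent_eq_diagonal {ι : Type*} [Fintype ι] [DecidableEq ι]
    {U : Matrix ι ι ℝ} (h1 : U * Uᵀ = 1) (h2 : Uᵀ * U = 1) (l : ι → ℝ) {z : ℂ}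
    (hz : 0 < z.im) :
    ((U * diagonal l * Uᵀ).map (fun a : ℝ => (a : ℂ)) - z • (1 : Matrix ι ι ℂ)) *
      (U.map Complex.ofRealHom * diagonal (fun i => ((l i : ℂ) - z)⁻¹) *
        (U.map Complex.ofRealHom)ᵀ) = 1 := by
  set V := U.map Complex.ofRealHom with hV
  have hV1 : V * Vᵀ = 1 := by
    rw [hV, ← transpose_map, ← Matrix.map_mul, h1]; simp
  have hV2 : Vᵀ * V = 1 := by
    rw [hV, ← transpose_map, ← Matrix.map_mul, h2]; simp
  have hm : (U * diagonal l * Uᵀ).map (fun a : ℝ => (a : ℂ)) - z • (1 : Matrix ι ι ℂ) =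
      V * diagonal (fun i => (l i : ℂ) - z) * Vᵀ := by
    have : (U * diagonal l * Uᵀ).map (fun a : ℝ => (a : ℂ)) =
        V * diagonal (fun i => (l i : ℂ)) * Vᵀ := by
      change (U * diagonal l * Uᵀ).map Complex.ofRealHom = _
      rw [Matrix.map_mul, Matrix.map_mul, hV, transpose_map, diagonal_map (by simp)]
      rfl
    rw [this]
    have hd : diagonal (fun i => (l i : ℂ) - z) = diagonal (fun i => (l i : ℂ)) - z • 1 := by
      ext i j
      by_cases h : i = j <;> simp [h]
    rw [hd, mul_sub, sub_mul, Matrix.mul_smul, Matrix.smul_mul, mul_one, hV1]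
  rw [hm]
  have hne : ∀ i, (l i : ℂ) - z ≠ 0 := fun i h => by
    have := congrArg Complex.im h
    simp at this; linarith
  calc V * diagonal (fun i => (l i : ℂ) - z) * Vᵀ *
        (V * diagonal (fun i => ((l i : ℂ) - z)⁻¹) * Vᵀ)
      = V * (diagonal (fun i => (l i : ℂ) - z) * (Vᵀ * V) *
          diagonal (fun i => ((l i : ℂ) - z)⁻¹)) * Vᵀ := by simp only [Matrix.mul_assoc]
    _ = 1 := by
      rw [hV2, mul_one, diagonal_mul_diagonal]
      simp [hne, hV1]

theorem dotProduct_conj_diagonal_mulVec {ι R : Type*} [Fintype ι] [DecidableEq ι] [CommRing R]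
    (V : Matrix ι ι R) (d : ι → R) (u : ι → R) :
    u ⬝ᵥ (V * diagonal d * Vᵀ) *ᵥ u = ∑ i, (Vᵀ *ᵥ u) i ^ 2 * d i := by
  rw [← mulVec_mulVec, ← mulVec_mulVec, dotProduct_mulVec, ← mulVec_transpose, dotProduct]
  refine Finset.sum_congr rfl fun i _ => ?_
  rw [mulVec_diagonal]; ring

theorem trace_mul_conj_diagonal {ι R : Type*} [Fintype ι] [DecidableEq ι] [CommRing R]
    (S V : Matrix ι ι R) (d : ι → R) :
    trace (S * (V * diagonal d * Vᵀ)) = ∑ i, (Vᵀ * S * V) i i * d i := by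
  rw [← Matrix.mul_assoc, trace_mul_comm, ← Matrix.mul_assoc, ← Matrix.mul_assoc, trace]
  exact Finset.sum_congr rfl fun i _ => by rw [diag_apply, mul_diagonal]

theorem stieltjesESD_conj_diagonal {p : ℕ} {U : Matrix (Fin p) (Fin p) ℝ} (h1 : U * Uᵀ = 1)
    (h2 : Uᵀ * U = 1) (l : Fin p → ℝ) {z : ℂ} (hz : 0 < z.im) :
    stieltjesESD (U * diagonal l * Uᵀ) z = (p : ℂ)⁻¹ * ∑ i, ((l i : ℂ) - z)⁻¹ := by
  rw [stieltjesESD, Matrix.inv_eq_right_inv (resolvent_eq_diagonal h1 h2 l hz),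
    trace_mul_comm, ← Matrix.mul_assoc, ← transpose_map, ← Matrix.map_mul, h2]
  simp [trace]

/-- The quotient `(∑ qᵢ gᵢ²) / (1 + ∑ qᵢ gᵢ)` with `gᵢ = (λᵢ - z)⁻¹`. -/
noncomputable def rankOneShift {p : ℕ} (l : Fin p → ℝ) (z : ℂ) (q : Fin p → ℝ) : ℂ :=
  (∑ i, (q i : ℂ) * (((l i : ℂ) - z)⁻¹) ^ 2) / (1 + ∑ i, (q i : ℂ) * ((l i : ℂ) - z)⁻¹)

theorem im_inv_sub (x : ℝ) (z : ℂ) : (((x : ℂ) - z)⁻¹).im = z.im * ‖((x : ℂ) - z)⁻¹‖ ^ 2 := by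
  rw [Complex.inv_im, norm_inv, inv_pow, ← Complex.normSq_eq_norm_sq]
  simp [div_eq_mul_inv]

theorem norm_inv_sub_le (x : ℝ) {z : ℂ} (hz : 0 < z.im) : ‖((x : ℂ) - z)⁻¹‖ ≤ z.im⁻¹ := by
  rw [norm_inv]
  apply inv_anti₀ hz
  have := Complex.abs_im_le_norm ((x : ℂ) - z)
  simp at this
  exact (le_abs_self _).trans this

/-- After multiplication by `z`, each summand becomes `q (l / (l - z) - 1)`, whose imaginary part is
nonnegative because `l` and `q` are. Hence the product has imaginary part at least `Im z`. -/
theorem im_div_norm_le_norm_one_add {ι : Type*} [Fintype ι] {l q : ι → ℝ} (hl : ∀ i, 0 ≤ l i)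
    (hq : ∀ i, 0 ≤ q i) {z : ℂ} (hz : 0 < z.im) :
    z.im / ‖z‖ ≤ ‖1 + ∑ i, (q i : ℂ) * ((l i : ℂ) - z)⁻¹‖ := by
  have hz0 : 0 < ‖z‖ := norm_pos_iff.2 fun h => by simp [h] at hz
  rw [div_le_iff₀ hz0, mul_comm, ← norm_mul]
  refine le_trans ?_ (le_trans (le_abs_self _) (Complex.abs_im_le_norm _))
  rw [mul_add, mul_one, Complex.add_im, Finset.mul_sum, Complex.im_sum]
  refine le_add_of_nonneg_right (Finset.sum_nonneg fun i _ => ?_)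
  have : z * ((q i : ℂ) * ((l i : ℂ) - z)⁻¹) = q i * (l i * ((l i : ℂ) - z)⁻¹ - 1) := by
    have hne : (l i : ℂ) - z ≠ 0 := fun h => by
      have := congrArg Complex.im h
      simp at this; linarith
    field_simp
    ring
  rw [this, Complex.im_ofReal_mul, Complex.sub_im, Complex.im_ofReal_mul, im_inv_sub]
  have := hl i
  have := hq i
  simp; positivity

/-- Since `Im g = Im z · |g|²` for `g = (l - z)⁻¹`, the sum of the norms on the left is exactly the
imaginary part of the denominator divided by `Im z`. The resulting bound on the quotient does not
depend on the size of `q`, so no moments of the columns are needed. -/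
theorem norm_sum_sq_le_norm_one_add {ι : Type*} [Fintype ι] {l q : ι → ℝ}
    (hq : ∀ i, 0 ≤ q i) {z : ℂ} (hz : 0 < z.im) :
    ‖∑ i, (q i : ℂ) * (((l i : ℂ) - z)⁻¹) ^ 2‖ ≤
      z.im⁻¹ * ‖1 + ∑ i, (q i : ℂ) * ((l i : ℂ) - z)⁻¹‖ := by
  refine le_trans (norm_sum_le _ _) ?_
  have h1 : ∑ i, ‖(q i : ℂ) * (((l i : ℂ) - z)⁻¹) ^ 2‖ =
      z.im⁻¹ * (1 + ∑ i, (q i : ℂ) * ((l i : ℂ) - z)⁻¹).im := by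
    rw [Complex.add_im, Complex.im_sum, Complex.one_im, zero_add, Finset.mul_sum]
    refine Finset.sum_congr rfl fun i _ => ?_
    rw [Complex.im_ofReal_mul, im_inv_sub, norm_mul, Complex.norm_of_nonneg (hq i), norm_pow]
    field_simp
  rw [h1]
  gcongr
  exact (le_abs_self _).trans (Complex.abs_im_le_norm _)

theorem one_add_sum_ne_zero {ι : Type*} [Fintype ι] {l q : ι → ℝ} (hl : ∀ i, 0 ≤ l i)
    (hq : ∀ i, 0 ≤ q i) {z : ℂ} (hz : 0 < z.im) :
    1 + ∑ i, (q i : ℂ) * ((l i : ℂ) - z)⁻¹ ≠ 0 := by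
  have hz0 : 0 < ‖z‖ := norm_pos_iff.2 fun h => by simp [h] at hz
  exact norm_pos_iff.1 ((div_pos hz hz0).trans_le (im_div_norm_le_norm_one_add hl hq hz))

theorem norm_rankOneShift_le {p : ℕ} {l q : Fin p → ℝ} (hl : ∀ i, 0 ≤ l i)
    (hq : ∀ i, 0 ≤ q i) {z : ℂ} (hz : 0 < z.im) : ‖rankOneShift l z q‖ ≤ z.im⁻¹ := by
  rw [rankOneShift, norm_div, div_le_iff₀ (norm_pos_iff.2 (one_add_sum_ne_zero hl hq hz))]
  exact norm_sum_sq_le_norm_one_add hq hz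

/-- Only two linear statistics of `q - r` matter. The denominator for `q` is bounded below, and the
quotient for `r` is bounded above by `1 / Im z`. -/
theorem norm_rankOneShift_sub_le {p : ℕ} {l q r : Fin p → ℝ} (hl : ∀ i, 0 ≤ l i)
    (hq : ∀ i, 0 ≤ q i) (hr : ∀ i, 0 ≤ r i) {z : ℂ} (hz : 0 < z.im) :
    ‖rankOneShift l z q - rankOneShift l z r‖ ≤ ‖z‖ / z.im *
      (‖∑ i, ((q i - r i : ℝ) : ℂ) * (((l i : ℂ) - z)⁻¹) ^ 2‖ +
        z.im⁻¹ * ‖∑ i, ((q i - r i : ℝ) : ℂ) * ((l i : ℂ) - z)⁻¹‖) := by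
  have hr' := norm_rankOneShift_le hl hr hz
  have e1 : ∑ i, ((q i - r i : ℝ) : ℂ) * (((l i : ℂ) - z)⁻¹) ^ 2 =
      ∑ i, (q i : ℂ) * (((l i : ℂ) - z)⁻¹) ^ 2 - ∑ i, (r i : ℂ) * (((l i : ℂ) - z)⁻¹) ^ 2 := by
    rw [← Finset.sum_sub_distrib]
    exact Finset.sum_congr rfl fun i _ => by push_cast; ring
  have e2 : ∑ i, ((q i - r i : ℝ) : ℂ) * (((l i : ℂ) - z)⁻¹) =
      (1 + ∑ i, (q i : ℂ) * ((l i : ℂ) - z)⁻¹) - (1 + ∑ i, (r i : ℂ) * ((l i : ℂ) - z)⁻¹) := by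
    rw [add_sub_add_left_eq_sub, ← Finset.sum_sub_distrib]
    exact Finset.sum_congr rfl fun i _ => by push_cast; ring
  rw [e1, e2]
  have hq1 := one_add_sum_ne_zero hl hq hz
  have hr1 := one_add_sum_ne_zero hl hr hz
  have hlow := im_div_norm_le_norm_one_add hl hq hz
  unfold rankOneShift at hr' ⊢
  generalize (∑ i, (q i : ℂ) * (((l i : ℂ) - z)⁻¹) ^ 2) = bq at *
  generalize (∑ i, (r i : ℂ) * (((l i : ℂ) - z)⁻¹) ^ 2) = br at *
  generalize (1 + ∑ i, (q i : ℂ) * (((l i : ℂ) - z)⁻¹)) = aq at *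
  generalize (1 + ∑ i, (r i : ℂ) * (((l i : ℂ) - z)⁻¹)) = ar at *
  have hz0 : 0 < ‖z‖ := norm_pos_iff.2 fun h => by simp [h] at hz
  have e3 : bq / aq - br / ar = aq⁻¹ * ((bq - br) - br / ar * (aq - ar)) := by
    field_simp
    ring
  rw [e3, norm_mul]
  gcongr
  · rw [norm_inv, ← inv_div]
    exact inv_anti₀ (div_pos hz hz0) hlow
  · refine (norm_sub_le _ _).trans ?_
    rw [norm_mul]
    gcongr

/-- Sherman–Morrison in the eigenbasis: both quadratic forms, in the resolvent and in its square,
become sums over squared coordinates of `Uᵀ t`. -/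
theorem stieltjesESD_conj_diagonal_add {p : ℕ} {U : Matrix (Fin p) (Fin p) ℝ} (h1 : U * Uᵀ = 1)
    (h2 : Uᵀ * U = 1) {l : Fin p → ℝ} (hl : ∀ i, 0 ≤ l i) {z : ℂ} (hz : 0 < z.im)
    {c : ℝ} (hc : 0 ≤ c) (t : Fin p → ℝ) :
    stieltjesESD (U * diagonal l * Uᵀ + c • vecMulVec t t) z =
      stieltjesESD (U * diagonal l * Uᵀ) z -
        (p : ℂ)⁻¹ * rankOneShift l z (fun i => c * (Uᵀ *ᵥ t) i ^ 2) := by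
  have hR := resolvent_eq_diagonal h1 h2 l hz
  set V := U.map Complex.ofRealHom with hV
  have hV2 : Vᵀ * V = 1 := by
    rw [hV, ← transpose_map, ← Matrix.map_mul, h2]; simp
  set u : Fin p → ℂ := fun i => (t i : ℂ) with hu
  have hs : ∀ i, (Vᵀ *ᵥ u) i = ((Uᵀ *ᵥ t) i : ℂ) := fun i => by
    simp [hV, hu, mulVec, dotProduct]
  have hd1 : u ⬝ᵥ (V * diagonal (fun i => ((l i : ℂ) - z)⁻¹) * Vᵀ) *ᵥ u =
      ∑ i, (((Uᵀ *ᵥ t) i : ℂ)) ^ 2 * ((l i : ℂ) - z)⁻¹ := by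
    rw [dotProduct_conj_diagonal_mulVec]
    simp only [hs]
  have hRt : (V * diagonal (fun i => ((l i : ℂ) - z)⁻¹) * Vᵀ)ᵀ =
      V * diagonal (fun i => ((l i : ℂ) - z)⁻¹) * Vᵀ := by
    simp [transpose_mul, Matrix.mul_assoc]
  have hd2 : (V * diagonal (fun i => ((l i : ℂ) - z)⁻¹) * Vᵀ) *ᵥ u ⬝ᵥ
      (V * diagonal (fun i => ((l i : ℂ) - z)⁻¹) * Vᵀ) *ᵥ u =
      ∑ i, (((Uᵀ *ᵥ t) i : ℂ)) ^ 2 * (((l i : ℂ) - z)⁻¹) ^ 2 := by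
    rw [dotProduct_mulVec, ← mulVec_transpose, hRt, mulVec_mulVec, dotProduct_comm]
    have : V * diagonal (fun i => ((l i : ℂ) - z)⁻¹) * Vᵀ *
        (V * diagonal (fun i => ((l i : ℂ) - z)⁻¹) * Vᵀ) =
        V * diagonal (fun i => (((l i : ℂ) - z)⁻¹) ^ 2) * Vᵀ := by
      calc _ = V * (diagonal (fun i => ((l i : ℂ) - z)⁻¹) * (Vᵀ * V) *
            diagonal (fun i => ((l i : ℂ) - z)⁻¹)) * Vᵀ := by simp only [Matrix.mul_assoc]
        _ = _ := by
          rw [hV2, mul_one, diagonal_mul_diagonal]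
          simp only [sq]
    rw [this, dotProduct_conj_diagonal_mulVec]
    simp only [hs]
  have hmap : (U * diagonal l * Uᵀ + c • vecMulVec t t).map (fun a : ℝ => (a : ℂ)) -
      z • (1 : Matrix (Fin p) (Fin p) ℂ) =
      ((U * diagonal l * Uᵀ).map (fun a : ℝ => (a : ℂ)) - z • (1 : Matrix (Fin p) (Fin p) ℂ)) +
        (c : ℂ) • vecMulVec u u := by
    ext i j
    simp only [Matrix.sub_apply, Matrix.map_apply, Matrix.add_apply, Matrix.smul_apply,
      smul_eq_mul, vecMulVec_apply, hu]
    push_cast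
    ring
  have hq : ∀ i, 0 ≤ c * (Uᵀ *ᵥ t) i ^ 2 := fun i => by positivity
  have hne := one_add_sum_ne_zero hl hq hz
  have hsum : ∀ f : Fin p → ℂ, ∑ i, ((c * (Uᵀ *ᵥ t) i ^ 2 : ℝ) : ℂ) * f i =
      c * ∑ i, (((Uᵀ *ᵥ t) i : ℂ)) ^ 2 * f i := fun f => by
    rw [Finset.mul_sum]
    exact Finset.sum_congr rfl fun i _ => by push_cast; ring
  rw [hsum, ← hd1] at hne
  rw [stieltjesESD, stieltjesESD, hmap, trace_inv_add_smul_vecMulVec _ _ hR hRt _ _ hne,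
    Matrix.inv_eq_right_inv hR, rankOneShift, hsum, hsum, hd1, hd2]
  ring

theorem norm_stieltjesESD_le {p : ℕ} {B : Matrix (Fin p) (Fin p) ℝ} (hB : B.PosSemidef)
    {z : ℂ} (hz : 0 < z.im) : ‖stieltjesESD B z‖ ≤ z.im⁻¹ := by
  obtain ⟨U, l, h1, h2, -, rfl⟩ := hB.exists_orthogonal_diagonalization
  rw [stieltjesESD_conj_diagonal h1 h2 l hz, norm_mul, norm_inv, Complex.norm_natCast]
  rcases Nat.eq_zero_or_pos p with rfl | hp
  · simp [hz.le]
  rw [inv_mul_le_iff₀ (by positivity)]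
  refine (norm_sum_le _ _).trans ?_
  refine (Finset.sum_le_sum fun i _ => norm_inv_sub_le (l i) hz).trans ?_
  simp

theorem norm_stieltjesESD_add_sub_le {p : ℕ} {B : Matrix (Fin p) (Fin p) ℝ} (hB : B.PosSemidef)
    {z : ℂ} (hz : 0 < z.im) {c : ℝ} (hc : 0 ≤ c) (t : Fin p → ℝ) :
    ‖stieltjesESD (B + c • vecMulVec t t) z - stieltjesESD B z‖ ≤ (p : ℝ)⁻¹ * z.im⁻¹ := by
  obtain ⟨U, l, h1, h2, hl, rfl⟩ := hB.exists_orthogonal_diagonalization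
  rw [stieltjesESD_conj_diagonal_add h1 h2 hl hz hc, sub_sub_cancel_left, norm_neg, norm_mul,
    norm_inv, Complex.norm_natCast]
  gcongr
  exact norm_rankOneShift_le hl (fun i => by positivity) hz

theorem measurable_stieltjesESD {p : ℕ} (z : ℂ) :
    Measurable fun A : Matrix (Fin p) (Fin p) ℝ => stieltjesESD A z := by
  have hc : Continuous fun A : Matrix (Fin p) (Fin p) ℝ =>
      A.map (fun a : ℝ => (a : ℂ)) - z • (1 : Matrix (Fin p) (Fin p) ℂ) :=
    (continuous_id.matrix_map Complex.continuous_ofReal).sub continuous_const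
  unfold stieltjesESD
  -- Inverse determinant times adjugate: both factors are measurable without any appeal to
  -- invertibility.
  simp only [Matrix.inv_def, trace_smul, Ring.inverse_eq_inv', smul_eq_mul]
  exact (hc.matrix_det.measurable.inv.mul
    (Continuous.matrix_trace hc.matrix_adjugate).measurable).const_mul _

end Deterministic

/-! ### Replacement and concentration for product measures -/

section ProductMeasure

variable {X : Type*} [MeasurableSpace X]

theorem integral_pi_succ {E : Type*} [NormedAddCommGroup E] [NormedSpace ℝ E]
    (μ : Measure X) [IsProbabilityMeasure μ] {n : ℕ}
    (f : (Fin (n + 1) → X) → E) :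
    ∫ x, f x ∂Measure.pi (fun _ : Fin (n + 1) => μ) =
      ∫ z : X × (Fin n → X), f (Fin.cons z.1 z.2) ∂μ.prod (Measure.pi fun _ : Fin n => μ) := by
  rw [← (measurePreserving_piFinSuccAbove (fun _ : Fin (n + 1) => μ) 0).symm.integral_comp']
  simp [MeasurableEquiv.piFinSuccAbove_symm_apply, Fin.insertNthEquiv]

theorem integrable_of_bounded {E : Type*} [NormedAddCommGroup E] {Y : Type*} [MeasurableSpace Y]
    {μ : Measure Y} [IsFiniteMeasure μ] {f : Y → E} (hf : StronglyMeasurable f) {C : ℝ}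
    (hC : ∀ y, ‖f y‖ ≤ C) : Integrable f μ :=
  Integrable.of_bound hf.aestronglyMeasurable C (Eventually.of_forall hC)

theorem measurable_finCons {n : ℕ} :
    Measurable fun z : X × (Fin n → X) => (Fin.cons z.1 z.2 : Fin (n + 1) → X) := by
  refine measurable_pi_lambda _ fun i => ?_
  refine Fin.cases ?_ (fun j => ?_) i
  · simpa using measurable_fst
  · simpa using measurable_snd.eval

/-- Telescoping: replacing the factors of a product measure one at a time. -/
theorem norm_integral_pi_sub_le {E : Type*} [NormedAddCommGroup E] [NormedSpace ℝ E]
    (μ ν : Measure X) [IsProbabilityMeasure μ] [IsProbabilityMeasure ν]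
    {δ C : ℝ} (n : ℕ) (f : (Fin n → X) → E) (hf : StronglyMeasurable f) (hC : ∀ x, ‖f x‖ ≤ C)
    (hδ : ∀ k x, ‖∫ t, f (Function.update x k t) ∂μ - ∫ t, f (Function.update x k t) ∂ν‖ ≤ δ) :
    ‖∫ x, f x ∂Measure.pi (fun _ : Fin n => μ) - ∫ x, f x ∂Measure.pi (fun _ : Fin n => ν)‖ ≤
      n * δ := by
  induction n with
  | zero =>
    have : Measure.pi (fun _ : Fin 0 => μ) = Measure.pi fun _ : Fin 0 => ν := by
      rw [Measure.pi_of_empty (fun _ : Fin 0 => μ) isEmptyElim,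
        Measure.pi_of_empty (fun _ : Fin 0 => ν) isEmptyElim]
    simp [this]
  | succ n ih =>
    rw [integral_pi_succ, integral_pi_succ]
    have hm : StronglyMeasurable fun z : X × (Fin n → X) =>
        f (Fin.cons z.1 z.2) := hf.comp_measurable measurable_finCons
    have hi : ∀ (ρ : Measure X) (σ : Measure (Fin n → X)) [IsProbabilityMeasure ρ]
        [IsProbabilityMeasure σ], Integrable (fun z : X × (Fin n → X) =>
        f (Fin.cons z.1 z.2)) (ρ.prod σ) :=
      fun ρ σ _ _ => integrable_of_bounded hm fun _ => hC _
    rw [integral_prod _ (hi _ _), integral_prod_symm _ (hi _ _)]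
    -- The intermediate measure is `μ ⊗ νⁿ`. Fubini lets it be compared with `μ ⊗ μⁿ` by induction
    -- and with `ν ⊗ νⁿ` by a single swap.
    have hmid : ∫ t, ∫ x, f (Fin.cons t x) ∂Measure.pi (fun _ : Fin n => ν) ∂μ =
        ∫ x, ∫ t, f (Fin.cons t x) ∂μ ∂Measure.pi (fun _ : Fin n => ν) :=
      integral_integral_swap (hi _ _)
    have h1 : ‖∫ t, ∫ x, f (Fin.cons t x) ∂Measure.pi (fun _ : Fin n => μ) ∂μ -
        ∫ t, ∫ x, f (Fin.cons t x) ∂Measure.pi (fun _ : Fin n => ν) ∂μ‖ ≤ n * δ := by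
      rw [← integral_sub (hi μ _).integral_prod_left (hi μ _).integral_prod_left]
      refine (norm_integral_le_of_norm_le_const (C := n * δ)
        (Eventually.of_forall fun t => ?_)).trans (by simp)
      refine ih (fun x => f (Fin.cons t x))
        (hm.comp_measurable measurable_prodMk_left) (fun _ => hC _) fun k x => ?_
      have := hδ k.succ (Fin.cons t x)
      simpa only [Fin.cons_update] using this
    have h2 : ‖∫ x, ∫ t, f (Fin.cons t x) ∂μ ∂Measure.pi (fun _ : Fin n => ν) -
        ∫ x, ∫ t, f (Fin.cons t x) ∂ν ∂Measure.pi (fun _ : Fin n => ν)‖ ≤ δ := by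
      rw [← integral_sub (hi μ _).integral_prod_right (hi ν _).integral_prod_right]
      refine (norm_integral_le_of_norm_le_const (C := δ)
        (Eventually.of_forall fun x => ?_)).trans (by simp)
      have hne : Nonempty X := μ.nonempty_of_neZero
      obtain ⟨t₀⟩ := hne
      have := hδ 0 (Fin.cons t₀ x)
      simpa only [Fin.update_cons_zero] using this
    calc _ ≤ _ := norm_sub_le_norm_sub_add_norm_sub _
            (∫ t, ∫ x, f (Fin.cons t x) ∂Measure.pi (fun _ : Fin n => ν) ∂μ) _
      _ ≤ n * δ + δ := add_le_add h1 (by rw [hmid]; exact h2)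
      _ = _ := by push_cast; ring

/-- **McDiarmid's inequality** in moment-generating-function form. -/
theorem hasSubgaussianMGF_pi_of_bounded_differences (μ : Measure X) [IsProbabilityMeasure μ]
    {c : NNReal} {C : ℝ} (n : ℕ) (f : (Fin n → X) → ℝ) (hf : Measurable f)
    (hC : ∀ x, ‖f x‖ ≤ C) (hc : ∀ k x s t,
      |f (Function.update x k s) - f (Function.update x k t)| ≤ c) :
    HasSubgaussianMGF (fun x => f x - ∫ x', f x' ∂Measure.pi (fun _ : Fin n => μ))
      (n * c ^ 2) (Measure.pi fun _ : Fin n => μ) := by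
  induction n with
  | zero =>
    have : (fun x => f x - ∫ x', f x' ∂Measure.pi (fun _ : Fin 0 => μ)) = fun _ => 0 := by
      ext x
      have h : ∀ x', f x' = f x := fun x' => congrArg f (Subsingleton.elim _ _)
      simp [h]
    rw [this]
    simp
  | succ n ih =>
    set π := Measure.pi fun _ : Fin n => μ with hπ
    have hm : Measurable fun z : X × (Fin n → X) => f (Fin.cons z.1 z.2) :=
      hf.comp measurable_finCons
    have hi : Integrable (fun z : X × (Fin n → X) => f (Fin.cons z.1 z.2)) (μ.prod π) :=
      integrable_of_bounded hm.stronglyMeasurable fun _ => hC _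
    set g : X → ℝ := fun t => ∫ x, f (Fin.cons t x) ∂π with hg
    have hgm : Measurable g := (hm.stronglyMeasurable.integral_prod_right').measurable
    have hgc : ∀ s t, |g s - g t| ≤ c := fun s t => by
      have hint : ∀ s, Integrable (fun x => f (Fin.cons s x)) π := fun s =>
        integrable_of_bounded (hm.comp measurable_prodMk_left).stronglyMeasurable fun _ => hC _
      rw [← Real.norm_eq_abs, hg, ← integral_sub (hint s) (hint t)]
      refine (norm_integral_le_of_norm_le_const (C := (c : ℝ))
        (Eventually.of_forall fun x => ?_)).trans (by simp)
      have := hc 0 (Fin.cons s x) s t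
      simpa only [Fin.update_cons_zero, Real.norm_eq_abs] using this
    have hE : ∫ x', f x' ∂Measure.pi (fun _ : Fin (n + 1) => μ) = ∫ t, g t ∂μ := by
      rw [integral_pi_succ, integral_prod _ hi]
    have hgC : ∀ t, ‖g t‖ ≤ C := fun t =>
      (norm_integral_le_of_norm_le_const (Eventually.of_forall fun x => hC _)).trans (by simp)
    -- Hoeffding's lemma on the interval of radius `c` around `g t₀` gives the parameter `c ^ 2`.
    -- This is not the sharp constant, but only its order matters.
    have hgS : HasSubgaussianMGF (fun t => g t - ∫ t', g t' ∂μ) (c ^ 2) μ := by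
      have hne : Nonempty X := μ.nonempty_of_neZero
      obtain ⟨t₀⟩ := hne
      have := hasSubgaussianMGF_of_mem_Icc (μ := μ) (X := g) (a := g t₀ - c) (b := g t₀ + c)
        hgm.aemeasurable (Eventually.of_forall fun t => by
          have := abs_le.1 (hgc t t₀)
          constructor <;> linarith)
      convert this using 1
      have h0 : ‖g t₀ + c - (g t₀ - c)‖₊ = 2 * c := by
        ext
        have : g t₀ + c - (g t₀ - c) = 2 * c := by ring
        rw [this]; simp
      rw [h0]
      simp
    have hS : ∀ t, HasSubgaussianMGF (fun x => f (Fin.cons t x) - g t) (n * c ^ 2) π := fun t => by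
      refine ih (fun x => f (Fin.cons t x)) (hm.comp measurable_prodMk_left) (fun _ => hC _)
        fun k x s s' => ?_
      have := hc k.succ (Fin.cons t x) s s'
      simpa only [Fin.cons_update] using this
    rw [hE]
    set m := ∫ t, g t ∂μ with hmdef
    have hmC : ‖m‖ ≤ C :=
      (norm_integral_le_of_norm_le_const (Eventually.of_forall hgC)).trans (by simp)
    have hexp : ∀ (r : ℝ) {Y : Type _} [MeasurableSpace Y] (ρ : Measure Y)
        [IsProbabilityMeasure ρ] (h : Y → ℝ), Measurable h → (∀ y, ‖h y‖ ≤ 2 * C) →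
        Integrable (fun y => Real.exp (r * h y)) ρ := fun r Y _ ρ _ h h1 h2 => by
      refine integrable_of_bounded (C := Real.exp (|r| * (2 * C)))
        (by fun_prop) fun y => ?_
      rw [Real.norm_eq_abs, Real.abs_exp, Real.exp_le_exp]
      refine (le_abs_self _).trans ?_
      rw [abs_mul]
      gcongr
      exact h2 y
    refine ⟨fun r => ?_, fun r => ?_⟩
    · refine hexp r _ _ (by fun_prop) fun x => ?_
      refine (norm_sub_le _ _).trans ?_
      linarith [hC x]
    · rw [mgf, integral_pi_succ]
      have hI : Integrable (fun z : X × (Fin n → X) =>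
          Real.exp (r * (f (Fin.cons z.1 z.2) - m))) (μ.prod π) := by
        refine hexp r _ _ (hm.sub_const m) fun x => ?_
        refine (norm_sub_le _ _).trans ?_
        linarith [hC (Fin.cons x.1 x.2)]
      rw [integral_prod _ hI]
      -- With the first coordinate frozen, the fluctuation splits into that of the remaining
      -- coordinates, handled by induction, and that of the partial mean `g`.
      have hin : ∀ t, ∫ x, Real.exp (r * (f (Fin.cons t x) - m)) ∂π ≤
          Real.exp (n * c ^ 2 * r ^ 2 / 2) * Real.exp (r * (g t - m)) := fun t => by
        have e : ∀ x, Real.exp (r * (f (Fin.cons t x) - m)) =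
            Real.exp (r * (f (Fin.cons t x) - g t)) * Real.exp (r * (g t - m)) := fun x => by
          rw [← Real.exp_add]; ring_nf
        simp_rw [e]
        rw [integral_mul_const]
        gcongr
        have := (hS t).mgf_le r
        simpa [mgf] using this
      calc _ ≤ ∫ t, Real.exp (n * c ^ 2 * r ^ 2 / 2) * Real.exp (r * (g t - m)) ∂μ :=
            integral_mono hI.integral_prod_left ((hgS.integrable_exp_mul r).const_mul _) hin
        _ ≤ Real.exp (n * c ^ 2 * r ^ 2 / 2) * Real.exp (c ^ 2 * r ^ 2 / 2) := by
            rw [integral_const_mul]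
            gcongr
            have := hgS.mgf_le r
            simpa [mgf] using this
        _ = _ := by
            rw [← Real.exp_add]
            push_cast
            ring_nf

end ProductMeasure

/-! ### Gaussian quadratic forms and the measurable square root -/

section GaussianQuadraticForm

open scoped Matrix.Norms.L2Operator in
theorem continuousOn_matrix_sqrt (p : ℕ) :
    ContinuousOn (CFC.sqrt : Matrix (Fin p) (Fin p) ℝ → Matrix (Fin p) (Fin p) ℝ)
      {A | A.PosSemidef} := by
  have h := CFC.continuousOn_sqrt (A := Matrix (Fin p) (Fin p) ℝ)
  refine h.mono fun A hA => ?_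
  exact hA.nonneg

theorem isClosed_posSemidef (p : ℕ) :
    IsClosed {A : Matrix (Fin p) (Fin p) ℝ | A.PosSemidef} := by
  have : {A : Matrix (Fin p) (Fin p) ℝ | A.PosSemidef} =
      {A | Aᵀ = A} ∩ ⋂ x : Fin p → ℝ, {A | 0 ≤ x ⬝ᵥ A *ᵥ x} := by
    ext A
    simp only [Set.mem_inter_iff, Set.mem_iInter, Set.mem_ofPred_eq]
    rw [Matrix.posSemidef_iff_dotProduct_mulVec]
    simp [IsHermitian, conjTranspose_eq_transpose_of_trivial]
  rw [this]
  refine (isClosed_eq (by fun_prop) (by fun_prop)).inter (isClosed_iInter fun x => ?_)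
  exact isClosed_le continuous_const (by fun_prop)

/-- `CFC.sqrt` restricted to positive semi-definite matrices and set to `0` elsewhere. -/
noncomputable def psdSqrt {p : ℕ} (A : Matrix (Fin p) (Fin p) ℝ) : Matrix (Fin p) (Fin p) ℝ :=
  open Classical in if A.PosSemidef then CFC.sqrt A else 0

theorem measurable_psdSqrt (p : ℕ) :
    Measurable (psdSqrt : Matrix (Fin p) (Fin p) ℝ → Matrix (Fin p) (Fin p) ℝ) := by
  classical
  have h : (psdSqrt : Matrix (Fin p) (Fin p) ℝ → Matrix (Fin p) (Fin p) ℝ) =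
      {A | A.PosSemidef}.piecewise CFC.sqrt (fun _ => 0) := by
    ext1 A
    simp [psdSqrt, Set.piecewise]
  rw [h]
  exact (continuousOn_matrix_sqrt p).measurable_piecewise continuousOn_const
    (isClosed_posSemidef p).measurableSet

/-- An orthogonal matrix is a linear isometry of Euclidean space, under which the standard Gaussian
is invariant; the rest is transport between `EuclideanSpace` and plain functions. -/
theorem map_pi_gaussianReal_mulVec {ι : Type*} [Fintype ι] [DecidableEq ι] {V : Matrix ι ι ℝ}
    (hV : Vᵀ * V = 1) :
    (Measure.pi fun _ : ι => gaussianReal 0 1).map (fun w => V *ᵥ w) =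
      Measure.pi fun _ : ι => gaussianReal 0 1 := by
  let li : EuclideanSpace ℝ ι →ₗᵢ[ℝ] EuclideanSpace ℝ ι :=
    { toLinearMap := (Matrix.toEuclideanCLM (n := ι) (𝕜 := ℝ) V).toLinearMap
      norm_map' := fun x => by
        have : ‖Matrix.toEuclideanCLM (n := ι) (𝕜 := ℝ) V x‖ ^ 2 = ‖x‖ ^ 2 := by
          rw [EuclideanSpace.real_norm_sq_eq, EuclideanSpace.real_norm_sq_eq]
          simp only [Matrix.ofLp_toEuclideanCLM]
          have h : (V *ᵥ x.ofLp) ⬝ᵥ (V *ᵥ x.ofLp) = x.ofLp ⬝ᵥ x.ofLp := by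
            rw [dotProduct_mulVec, ← mulVec_transpose, mulVec_mulVec, hV, one_mulVec]
          simpa [dotProduct, sq] using h
        exact (sq_eq_sq₀ (norm_nonneg _) (norm_nonneg _)).1 this }
  let e := li.toLinearIsometryEquiv rfl
  have he := stdGaussian_map e
  rw [← map_pi_eq_stdGaussian, Measure.map_map (by fun_prop) (by fun_prop)] at he
  have h2 := congrArg (Measure.map (WithLp.ofLp : EuclideanSpace ℝ ι → ι → ℝ)) he
  rw [Measure.map_map (by fun_prop) (by fun_prop), Measure.map_map (by fun_prop) (by fun_prop)]
    at h2
  have e1 : (WithLp.ofLp : EuclideanSpace ℝ ι → ι → ℝ) ∘ (e ∘ WithLp.toLp 2) =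
      fun w => V *ᵥ w := rfl
  have e2 : (WithLp.ofLp : EuclideanSpace ℝ ι → ι → ℝ) ∘ (WithLp.toLp 2) = id := rfl
  rwa [e1, e2, Measure.map_id] at h2

theorem trace_conj_diagonal_sq {ι : Type*} [Fintype ι] [DecidableEq ι] {U : Matrix ι ι ℝ}
    (h2 : Uᵀ * U = 1) (l : ι → ℝ) : trace ((U * diagonal l * Uᵀ) ^ 2) = ∑ i, l i ^ 2 := by
  have : (U * diagonal l * Uᵀ) ^ 2 = U * diagonal (fun i => l i ^ 2) * Uᵀ := by
    calc _ = U * (diagonal l * (Uᵀ * U) * diagonal l) * Uᵀ := by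
          simp only [sq, Matrix.mul_assoc]
      _ = _ := by rw [h2, mul_one, diagonal_mul_diagonal]; simp only [sq]
  rw [this, trace_mul_comm, ← Matrix.mul_assoc, h2]
  simp

theorem memLp_sq_gaussianReal : MemLp (fun x : ℝ => x ^ 2) 2 (gaussianReal 0 1) := by
  have h42 : (4 : ENNReal)⁻¹ + 4⁻¹ = 2⁻¹ := by
    have h4 : (4 : ENNReal)⁻¹ = 2⁻¹ * 2⁻¹ := by
      rw [← ENNReal.mul_inv (by simp) (by simp)]; norm_num
    rw [h4, ← mul_add, ENNReal.inv_two_add_inv_two, mul_one]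
  have h : MemLp (fun x : ℝ => x * x) 2 (gaussianReal 0 1) :=
    MemLp.mul (p := 4) (q := 4) (memLp_id_gaussianReal 4) (memLp_id_gaussianReal 4)
      (hpqr := ⟨h42⟩)
  simpa only [sq] using h

theorem integral_sq_gaussianReal : ∫ x, x ^ 2 ∂gaussianReal 0 1 = 1 := by
  have h := variance_fun_id_gaussianReal (μ := 0) (v := 1)
  rw [variance_eq_sub (X := fun x => x) (memLp_id_gaussianReal 2)] at h
  simpa using h

/-- Chebyshev's inequality for a quadratic form in a standard normal vector. -/
theorem gaussian_quadraticForm_chebyshev {p : ℕ} {C : Matrix (Fin p) (Fin p) ℝ}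
    (hC : C.IsHermitian) {δ : ℝ} (hδ : 0 < δ) :
    (Measure.pi fun _ : Fin p => gaussianReal 0 1) {w | δ ≤ |w ⬝ᵥ C *ᵥ w - trace C|} ≤
      ENNReal.ofReal (Var[fun x => x ^ 2; gaussianReal 0 1] * trace (C ^ 2) / δ ^ 2) := by
  obtain ⟨U, h1, h2, h3⟩ := exists_orthogonal_diagonalization hC
  set l := hC.eigenvalues
  set γ := Measure.pi fun _ : Fin p => gaussianReal 0 1 with hγ
  set κ := Var[fun x => x ^ 2; gaussianReal 0 1]
  set F : (Fin p → ℝ) → ℝ := ∑ i, fun w => l i * (w i) ^ 2 with hF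
  have hL : ∀ i, MemLp (fun x : ℝ => l i * x ^ 2) 2 (gaussianReal 0 1) :=
    fun i => memLp_sq_gaussianReal.const_mul (l i)
  have hLw : ∀ i, MemLp (fun w : Fin p → ℝ => l i * (w i) ^ 2) 2 γ := fun i =>
    (hL i).comp_measurePreserving (measurePreserving_eval _ i)
  have hFL : MemLp F 2 γ := memLp_finsetSum' _ fun i _ => hLw i
  have hvar : Var[F; γ] = κ * trace (C ^ 2) := by
    rw [hF, hγ, variance_sum_pi hL, h3, trace_conj_diagonal_sq h2, Finset.mul_sum]
    refine Finset.sum_congr rfl fun i _ => ?_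
    rw [variance_const_mul]; ring
  have htr : trace C = ∑ i, l i := by
    rw [h3, trace_mul_comm, ← Matrix.mul_assoc, h2]; simp
  have hmean : ∫ w, F w ∂γ = trace C := by
    rw [htr, hF]
    simp only [Finset.sum_apply]
    rw [integral_finsetSum _ fun i _ => (hLw i).integrable (by norm_num)]
    refine Finset.sum_congr rfl fun i _ => ?_
    have := integral_comp_eval (μ := fun _ : Fin p => gaussianReal 0 1) (i := i)
      (f := fun x : ℝ => l i * x ^ 2) (hL i).aestronglyMeasurable
    rw [hγ, this, integral_const_mul, integral_sq_gaussianReal, mul_one]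
  -- By rotation invariance the form may be read in the eigenbasis, where it is a sum of independent
  -- terms `lᵢ wᵢ²`.
  have hquad : ∀ w, w ⬝ᵥ C *ᵥ w = F (Uᵀ *ᵥ w) := fun w => by
    rw [h3, dotProduct_conj_diagonal_mulVec, hF, Finset.sum_apply]
    exact Finset.sum_congr rfl fun i _ => mul_comm _ _
  have hrot := map_pi_gaussianReal_mulVec (V := Uᵀ) (by rwa [transpose_transpose])
  have hFm : Measurable F := by
    rw [hF]; fun_prop
  calc γ {w | δ ≤ |w ⬝ᵥ C *ᵥ w - trace C|}
      = γ ((fun w => Uᵀ *ᵥ w) ⁻¹' {w | δ ≤ |F w - trace C|}) := by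
        simp only [hquad]; rfl
    _ = γ {w | δ ≤ |F w - trace C|} := by
        rw [← Measure.map_apply (by fun_prop) (measurableSet_le (by fun_prop) (by fun_prop)), hrot]
    _ ≤ _ := by
        rw [← hmean, ← hvar]
        exact meas_ge_le_variance_div_sq hFL hδ

theorem sum_sq_mulVec_le {p : ℕ} (A : Matrix (Fin p) (Fin p) ℝ) (x : Fin p → ℝ) :
    ∑ i, (A *ᵥ x) i ^ 2 ≤ matrixSpectralNorm A ^ 2 * ∑ i, x i ^ 2 := by
  have h := (Matrix.toEuclideanCLM (n := Fin p) (𝕜 := ℝ) A).le_opNorm (WithLp.toLp 2 x)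
  have h2 := pow_le_pow_left₀ (norm_nonneg _) h 2
  rw [mul_pow, EuclideanSpace.real_norm_sq_eq, EuclideanSpace.real_norm_sq_eq] at h2
  simpa [matrixSpectralNorm] using h2

theorem trace_sq_le {ι : Type*} [Fintype ι] [DecidableEq ι] (X : Matrix ι ι ℝ) :
    trace (X ^ 2) ≤ ∑ j, ∑ i, X i j ^ 2 := by
  have h1 : trace (X ^ 2) = ∑ i, ∑ j, X i j * X j i := by
    simp [sq, trace, Matrix.mul_apply]
  have h2 : ∑ i, ∑ j, X j i ^ 2 = ∑ i, ∑ j, X i j ^ 2 := Finset.sum_comm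
  have h3 : ∑ i, ∑ j, X i j * X j i ≤ ∑ i, ∑ j, (X i j ^ 2 + X j i ^ 2) / 2 :=
    Finset.sum_le_sum fun i _ => Finset.sum_le_sum fun j _ => by
      nlinarith [sq_nonneg (X i j - X j i)]
  have h4 : ∑ i, ∑ j, (X i j ^ 2 + X j i ^ 2) / 2 = ∑ i, ∑ j, X j i ^ 2 := by
    simp only [← Finset.sum_div, Finset.sum_add_distrib]
    rw [h2]; ring
  rw [h1]
  exact h3.trans h4.le

/-- Cyclicity turns the left side into `tr ((A s)²)`, which is at most the squared Frobenius norm of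
`A s`. Applying `A` column by column costs its operator norm, and for symmetric `s` the squared
Frobenius norm is `tr (s²)`. -/
theorem trace_sandwich_sq_le {p : ℕ} (A : Matrix (Fin p) (Fin p) ℝ)
    {s r : Matrix (Fin p) (Fin p) ℝ} (hs : sᵀ = s) (hr : r * r = s) :
    trace ((r * A * r) ^ 2) ≤ matrixSpectralNorm A ^ 2 * trace (s ^ 2) := by
  have h1 : trace ((r * A * r) ^ 2) = trace ((A * s) ^ 2) := by
    rw [sq, sq, ← hr]
    calc trace (r * A * r * (r * A * r)) = trace (r * (A * r * (r * A * r))) := by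
          simp only [Matrix.mul_assoc]
      _ = trace (A * r * (r * A * r) * r) := trace_mul_comm _ _
      _ = _ := by simp only [Matrix.mul_assoc]
  rw [h1]
  refine (trace_sq_le _).trans ?_
  have h2 : trace (s ^ 2) = ∑ j, ∑ i, s i j ^ 2 := by
    rw [sq]
    nth_rw 1 [← hs]
    simp [trace, Matrix.mul_apply, sq]
  rw [h2, Finset.mul_sum]
  refine Finset.sum_le_sum fun j _ => ?_
  exact sum_sq_mulVec_le A (fun i => s i j)

end GaussianQuadraticForm

/-! ### The weak law for Gaussian mixtures -/

section GaussianWLLN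

theorem tendstoInMeasure_zero_iff {Ω : Type*} [MeasurableSpace Ω] {P : Measure Ω}
    {f : ℕ → Ω → ℝ} :
    TendstoInMeasure P f atTop (fun _ => 0) ↔
      ∀ ε : ℝ, 0 < ε → Tendsto (fun i => P {ω | ε ≤ |f i ω|}) atTop (𝓝 0) := by
  rw [tendstoInMeasure_iff_norm]
  simp

/-- By independence the joint law of `(S, w)` is a product, so Chebyshev applies on each slice `S =
s`. Slices with `tr (s²) ≥ η` are charged to the first term on the right; on the others the variance
is uniformly bounded. -/
theorem gaussian_mixture_quadraticForm_le {Ω₀ : Type*} [MeasurableSpace Ω₀] {P₀ : Measure Ω₀}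
    [IsProbabilityMeasure P₀] {p : ℕ} {S : Ω₀ → Matrix (Fin p) (Fin p) ℝ} (hS : Measurable S)
    (hSpos : ∀ ω, (S ω).PosSemidef) {w : Ω₀ → (Fin p → ℝ)}
    (hw : HasLaw w (Measure.pi fun _ : Fin p => gaussianReal 0 1) P₀) (hwS : IndepFun w S P₀)
    {A : Matrix (Fin p) (Fin p) ℝ} (hA : A.IsHermitian) {δ η : ℝ} (hδ : 0 < δ) :
    P₀ {ω | δ ≤ |(CFC.sqrt (S ω) *ᵥ w ω) ⬝ᵥ (A *ᵥ (CFC.sqrt (S ω) *ᵥ w ω)) -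
        trace (S ω * A)|} ≤
      P₀ {ω | η ≤ trace (S ω ^ 2)} + ENNReal.ofReal
        (Var[fun x => x ^ 2; gaussianReal 0 1] * (matrixSpectralNorm A ^ 2 * η) / δ ^ 2) := by
  set γ := Measure.pi fun _ : Fin p => gaussianReal 0 1 with hγ
  set κ := Var[fun x => x ^ 2; gaussianReal 0 1]
  -- Using `psdSqrt` makes this event measurable; it agrees with `CFC.sqrt` on the slices that
  -- matter.
  set E : Set (Matrix (Fin p) (Fin p) ℝ × (Fin p → ℝ)) :=
    {x | x.1.PosSemidef ∧ trace (x.1 ^ 2) < η ∧ δ ≤ |(psdSqrt x.1 *ᵥ x.2) ⬝ᵥ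
      (A *ᵥ (psdSqrt x.1 *ᵥ x.2)) - trace (x.1 * A)|} with hE
  have hr : Measurable fun x : Matrix (Fin p) (Fin p) ℝ × (Fin p → ℝ) =>
      psdSqrt x.1 *ᵥ x.2 := by
    have hc : Continuous fun x : Matrix (Fin p) (Fin p) ℝ × (Fin p → ℝ) => x.1 *ᵥ x.2 := by
      fun_prop
    exact hc.measurable.comp (((measurable_psdSqrt p).comp measurable_fst).prodMk measurable_snd)
  have hq : Continuous fun t : Fin p → ℝ => t ⬝ᵥ (A *ᵥ t) := by fun_prop
  have ht : Continuous fun s : Matrix (Fin p) (Fin p) ℝ => trace (s * A) := by fun_prop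
  have ht2 : Continuous fun s : Matrix (Fin p) (Fin p) ℝ => trace (s ^ 2) := by fun_prop
  have hEm : MeasurableSet E := by
    have m1 : MeasurableSet {x : Matrix (Fin p) (Fin p) ℝ × (Fin p → ℝ) | x.1.PosSemidef} :=
      measurable_fst (isClosed_posSemidef p).measurableSet
    have m2 : MeasurableSet {x : Matrix (Fin p) (Fin p) ℝ × (Fin p → ℝ) | trace (x.1 ^ 2) < η} :=
      measurableSet_lt (ht2.measurable.comp measurable_fst) measurable_const
    have m3 : MeasurableSet {x : Matrix (Fin p) (Fin p) ℝ × (Fin p → ℝ) |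
        δ ≤ |(psdSqrt x.1 *ᵥ x.2) ⬝ᵥ (A *ᵥ (psdSqrt x.1 *ᵥ x.2)) - trace (x.1 * A)|} :=
      measurableSet_le measurable_const
        (((hq.measurable.comp hr).sub (ht.measurable.comp measurable_fst)).abs)
    exact m1.inter (m2.inter m3)
  have hlaw : P₀.map (fun ω => (S ω, w ω)) = (P₀.map S).prod γ := by
    rw [(indepFun_iff_map_prod_eq_prod_map_map hS.aemeasurable hw.aemeasurable).1 hwS.symm,
      hw.map_eq]
  have hprob : IsProbabilityMeasure (P₀.map S) := Measure.isProbabilityMeasure_map hS.aemeasurable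
  have hEle : P₀ ((fun ω => (S ω, w ω)) ⁻¹' E) ≤
      ENNReal.ofReal (κ * (matrixSpectralNorm A ^ 2 * η) / δ ^ 2) := by
    rw [← Measure.map_apply_of_aemeasurable (hS.aemeasurable.prodMk hw.aemeasurable) hEm, hlaw,
      Measure.prod_apply hEm]
    calc ∫⁻ s, γ (Prod.mk s ⁻¹' E) ∂P₀.map S
        ≤ ∫⁻ _, ENNReal.ofReal (κ * (matrixSpectralNorm A ^ 2 * η) / δ ^ 2) ∂P₀.map S := by
          refine lintegral_mono fun s => ?_
          by_cases hs : s.PosSemidef ∧ trace (s ^ 2) < η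
          · obtain ⟨hs1, hs2⟩ := hs
            have hsq : psdSqrt s = CFC.sqrt s := by simp [psdSqrt, hs1]
            have hrr : CFC.sqrt s * CFC.sqrt s = s := CFC.sqrt_mul_sqrt_self s hs1.nonneg
            have hrt : (CFC.sqrt s)ᵀ = CFC.sqrt s := by
              have := (CFC.sqrt_nonneg s).posSemidef.1
              rwa [IsHermitian, conjTranspose_eq_transpose_of_trivial] at this
            have hst : sᵀ = s := by
              have := hs1.1
              rwa [IsHermitian, conjTranspose_eq_transpose_of_trivial] at this
            have hAt : Aᵀ = A := by
              have := hA
              rwa [IsHermitian, conjTranspose_eq_transpose_of_trivial] at this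
            set r := CFC.sqrt s
            have hC : (r * A * r).IsHermitian := by
              rw [IsHermitian, conjTranspose_eq_transpose_of_trivial, transpose_mul,
                transpose_mul, hrt, hAt, Matrix.mul_assoc]
            have htrC : trace (r * A * r) = trace (s * A) := by
              rw [trace_mul_comm, ← Matrix.mul_assoc, hrr]
            have hqC : ∀ v, (r *ᵥ v) ⬝ᵥ (A *ᵥ (r *ᵥ v)) = v ⬝ᵥ (r * A * r) *ᵥ v := fun v => by
              rw [← mulVec_mulVec, ← mulVec_mulVec, dotProduct_mulVec v r, ← mulVec_transpose, hrt]
            have hsub : Prod.mk s ⁻¹' E ⊆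
                {v | δ ≤ |v ⬝ᵥ (r * A * r) *ᵥ v - trace (r * A * r)|} := fun v hv => by
              have := hv.2.2
              simp only [hsq, hqC] at this
              simpa only [Set.mem_ofPred_eq, htrC] using this
            refine (measure_mono hsub).trans ((gaussian_quadraticForm_chebyshev hC hδ).trans ?_)
            have hκ : 0 ≤ κ := variance_nonneg _ _
            have := trace_sandwich_sq_le A hst hrr
            gcongr
            exact this.trans (by gcongr)
          · have : Prod.mk s ⁻¹' E = ∅ := by
              ext v
              simp only [Set.mem_preimage, hE, Set.mem_ofPred_eq, Set.mem_empty_iff_false,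
                iff_false]
              exact fun h => hs ⟨h.1, h.2.1⟩
            simp [this]
      _ = _ := by simp
  refine (measure_mono ?_).trans ((measure_union_le _ _).trans (add_le_add le_rfl hEle))
  intro ω hω
  by_cases h : η ≤ trace (S ω ^ 2)
  · exact Or.inl h
  · refine Or.inr ⟨hSpos ω, not_le.1 h, ?_⟩
    simpa [psdSqrt, hSpos ω] using hω

/-- Given `Σ`, the normalised form has variance of order at most `M² tr (Σ²) / p²`, which (A2) makes
small in probability. -/
theorem quadraticFormWLLN_gaussian_mixture {Ω₀ : Type*} [MeasurableSpace Ω₀] {P₀ : Measure Ω₀}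
    [IsProbabilityMeasure P₀] {S : (p : ℕ) → Ω₀ → Matrix (Fin p) (Fin p) ℝ}
    (hS : ∀ p, Measurable (S p)) (hSpos : ∀ p ω, (S p ω).PosSemidef)
    {w : (p : ℕ) → Ω₀ → (Fin p → ℝ)}
    (hw : ∀ p, HasLaw (w p) (Measure.pi fun _ : Fin p => gaussianReal 0 1) P₀)
    (hwS : ∀ p, IndepFun (w p) (S p) P₀) (hA2 : TraceSqNegligible P₀ S) :
    QuadraticFormWLLN P₀ (fun p ω => CFC.sqrt (S p ω) *ᵥ w p ω) S := by
  intro A hA ⟨M, hM⟩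
  rw [tendstoInMeasure_zero_iff]
  intro ε hε
  have hM0 : 0 ≤ M := (norm_nonneg _).trans (hM 0)
  set κ := Var[fun x => x ^ 2; gaussianReal 0 1]
  have hκ : 0 ≤ κ := variance_nonneg _ _
  rw [ENNReal.tendsto_nhds_zero]
  intro θ hθ
  obtain ⟨τ, hτ0, hτ⟩ : ∃ τ : ℝ, 0 < τ ∧ ENNReal.ofReal τ ≤ θ / 2 := by
    rcases eq_or_ne θ ⊤ with rfl | hθt
    · exact ⟨1, one_pos, by simp [ENNReal.top_div]⟩
    · refine ⟨(θ / 2).toReal, ENNReal.toReal_pos (by simpa using hθ.ne') ?_, ?_⟩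
      · exact ENNReal.div_ne_top hθt (by simp)
      · exact ENNReal.ofReal_toReal_le
  -- Chosen so that the Chebyshev term is at most `τ`; the `+ 1` keeps the denominator positive when
  -- `M = 0`.
  set η := τ * ε ^ 2 / (κ * M ^ 2 + 1) with hη
  have hη0 : 0 < η := by positivity
  have h2 := tendstoInMeasure_zero_iff.1 hA2 η hη0
  rw [ENNReal.tendsto_nhds_zero] at h2
  filter_upwards [h2 (θ / 2) (ENNReal.half_pos hθ.ne'), eventually_gt_atTop 0] with p hp hp0
  have hp0' : (0 : ℝ) < p := by exact_mod_cast hp0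
  have hb := gaussian_mixture_quadraticForm_le (hS p) (hSpos p) (hw p) (hwS p) (hA p).1
    (δ := ε * p) (η := η * p ^ 2) (by positivity)
  have e1 : {ω | ε ≤ |((CFC.sqrt (S p ω) *ᵥ w p ω) ⬝ᵥ (A p *ᵥ (CFC.sqrt (S p ω) *ᵥ w p ω)) -
      trace (S p ω * A p)) / (p : ℝ)|} =
      {ω | ε * p ≤ |(CFC.sqrt (S p ω) *ᵥ w p ω) ⬝ᵥ (A p *ᵥ (CFC.sqrt (S p ω) *ᵥ w p ω)) -
      trace (S p ω * A p)|} := by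
    ext ω
    simp only [Set.mem_ofPred_eq]
    rw [abs_div, Nat.abs_cast, le_div_iff₀ hp0']
  have e2 : P₀ {ω | η * p ^ 2 ≤ trace (S p ω ^ 2)} ≤ θ / 2 := by
    refine (measure_mono fun ω hω => ?_).trans hp
    simp only [Set.mem_ofPred_eq] at hω ⊢
    exact le_trans ((le_div_iff₀ (by positivity)).2 hω) (le_abs_self _)
  rw [e1]
  refine hb.trans ((add_le_add e2 ((ENNReal.ofReal_le_ofReal ?_).trans hτ)).trans_eq
    (ENNReal.add_halves θ))
  have hMp : matrixSpectralNorm (A p) ^ 2 ≤ M ^ 2 :=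
    pow_le_pow_left₀ (norm_nonneg _) (hM p) 2
  calc κ * (matrixSpectralNorm (A p) ^ 2 * (η * p ^ 2)) / (ε * p) ^ 2
      ≤ κ * (M ^ 2 * (η * p ^ 2)) / (ε * p) ^ 2 := by gcongr
    _ = κ * M ^ 2 / (κ * M ^ 2 + 1) * τ := by
        rw [hη]; field_simp
    _ ≤ 1 * τ := by
        gcongr
        rw [div_le_one (by positivity)]
        linarith
    _ = τ := one_mul τ

end GaussianWLLN

/-! ### Uniformity of the weak law over test matrices -/

section UniformWLLN

/-- The weak law for quadratic forms holds uniformly over positive semi-definite matrices of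
bounded spectral norm. -/
theorem QuadraticFormWLLN.uniform {Ω₀ : Type*} [MeasurableSpace Ω₀] {P₀ : Measure Ω₀}
    {y : (p : ℕ) → Ω₀ → (Fin p → ℝ)}
    {S : (p : ℕ) → Ω₀ → Matrix (Fin p) (Fin p) ℝ} (h : QuadraticFormWLLN P₀ y S)
    (M : ℝ) (hM : 0 ≤ M) {ε : ℝ} (hε : 0 < ε) {θ : ENNReal} (hθ : 0 < θ) :
    ∀ᶠ p : ℕ in atTop, ∀ A : Matrix (Fin p) (Fin p) ℝ, A.PosSemidef → matrixSpectralNorm A ≤ M →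
      P₀ {ω | ε * p ≤ |y p ω ⬝ᵥ (A *ᵥ y p ω) - trace (S p ω * A)|} ≤ θ := by
  classical
  -- For each `p` pick a matrix violating the bound if there is one, and `0` otherwise. The weak law
  -- along this single sequence then excludes violators for all large `p`.
  have hex : ∀ p : ℕ, ∃ A : Matrix (Fin p) (Fin p) ℝ, A.PosSemidef ∧ matrixSpectralNorm A ≤ M ∧
      ((∃ B : Matrix (Fin p) (Fin p) ℝ, B.PosSemidef ∧ matrixSpectralNorm B ≤ M ∧
        θ < P₀ {ω | ε * p ≤ |y p ω ⬝ᵥ (B *ᵥ y p ω) - trace (S p ω * B)|}) →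
        θ < P₀ {ω | ε * p ≤ |y p ω ⬝ᵥ (A *ᵥ y p ω) - trace (S p ω * A)|}) := fun p => by
    by_cases hB : ∃ B : Matrix (Fin p) (Fin p) ℝ, B.PosSemidef ∧ matrixSpectralNorm B ≤ M ∧
        θ < P₀ {ω | ε * p ≤ |y p ω ⬝ᵥ (B *ᵥ y p ω) - trace (S p ω * B)|}
    · obtain ⟨B, h1, h2, h3⟩ := hB
      exact ⟨B, h1, h2, fun _ => h3⟩
    · exact ⟨0, PosSemidef.zero, by simpa [matrixSpectralNorm] using hM, fun h' => absurd h' hB⟩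
  choose A hA1 hA2 hA3 using hex
  have ht := tendstoInMeasure_zero_iff.1 (h A hA1 ⟨M, hA2⟩) ε hε
  rw [ENNReal.tendsto_nhds_zero] at ht
  filter_upwards [ht θ hθ, eventually_gt_atTop 0] with p hp hp0 B hB1 hB2
  by_contra hcon
  have := hA3 p ⟨B, hB1, hB2, not_le.1 hcon⟩
  refine absurd hp (not_le.2 (this.trans_le (measure_mono fun ω hω => ?_)))
  have hp0' : (0 : ℝ) < p := by exact_mod_cast hp0
  simp only [Set.mem_ofPred_eq] at hω ⊢
  rwa [abs_div, Nat.abs_cast, le_div_iff₀ hp0']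

theorem matrixSpectralNorm_conj_diagonal_le {p : ℕ} {U : Matrix (Fin p) (Fin p) ℝ}
    (h1 : U * Uᵀ = 1) (h2 : Uᵀ * U = 1) {f : Fin p → ℝ} {K : ℝ} (hK : 0 ≤ K)
    (hf : ∀ i, |f i| ≤ K) : matrixSpectralNorm (U * diagonal f * Uᵀ) ≤ K := by
  have hiso : ∀ {V : Matrix (Fin p) (Fin p) ℝ}, Vᵀ * V = 1 → ∀ x : Fin p → ℝ,
      ∑ i, (V *ᵥ x) i ^ 2 = ∑ i, x i ^ 2 := fun {V} hV x => by
    have h : (V *ᵥ x) ⬝ᵥ (V *ᵥ x) = x ⬝ᵥ x := by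
      rw [dotProduct_mulVec, ← mulVec_transpose, mulVec_mulVec, hV, one_mulVec]
    simpa [dotProduct, sq] using h
  refine ContinuousLinearMap.opNorm_le_bound _ hK fun x => ?_
  refine (sq_le_sq₀ (norm_nonneg _) (by positivity)).1 ?_
  rw [mul_pow, EuclideanSpace.real_norm_sq_eq, EuclideanSpace.real_norm_sq_eq]
  simp only [Matrix.ofLp_toEuclideanCLM]
  rw [← mulVec_mulVec, ← mulVec_mulVec, hiso h2,
    ← hiso (V := Uᵀ) (by rwa [transpose_transpose]) x.ofLp, Finset.mul_sum]
  refine Finset.sum_le_sum fun i _ => ?_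
  rw [mulVec_diagonal, mul_pow]
  gcongr ?_ * _
  exact sq_le_sq' (abs_le.1 (hf i)).1 (abs_le.1 (hf i)).2

theorem posSemidef_conj_diagonal {ι : Type*} [Fintype ι] [DecidableEq ι] (U : Matrix ι ι ℝ)
    {f : ι → ℝ} (hf : ∀ i, 0 ≤ f i) : (U * diagonal f * Uᵀ).PosSemidef := by
  have := (PosSemidef.diagonal (n := ι) hf).mul_mul_conjTranspose_same U
  rwa [conjTranspose_eq_transpose_of_trivial] at this

/-- Removes the sign restriction: `f = (f + K) - K` is a difference of weights in `[0, 2K]`, each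
giving a positive semi-definite test matrix. -/
theorem QuadraticFormWLLN.uniform_diagonal {Ω₀ : Type*} [MeasurableSpace Ω₀] {P₀ : Measure Ω₀}
    {y : (p : ℕ) → Ω₀ → (Fin p → ℝ)}
    {S : (p : ℕ) → Ω₀ → Matrix (Fin p) (Fin p) ℝ} (h : QuadraticFormWLLN P₀ y S)
    (K : ℝ) (hK : 0 ≤ K) {ε : ℝ} (hε : 0 < ε) {θ : ENNReal} (hθ : 0 < θ) :
    ∀ᶠ p : ℕ in atTop, ∀ U : Matrix (Fin p) (Fin p) ℝ, U * Uᵀ = 1 → Uᵀ * U = 1 →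
      ∀ f : Fin p → ℝ, (∀ i, |f i| ≤ K) →
      P₀ {ω | ε * p ≤ |∑ i, ((Uᵀ *ᵥ y p ω) i ^ 2 - (Uᵀ * S p ω * U) i i) * f i|} ≤ θ := by
  filter_upwards [h.uniform (2 * K) (by positivity) (half_pos hε) (ENNReal.half_pos hθ.ne')]
    with p hp U h1 h2 f hf
  have key : ∀ (g : Fin p → ℝ) ω, ∑ i, ((Uᵀ *ᵥ y p ω) i ^ 2 - (Uᵀ * S p ω * U) i i) * g i =
      y p ω ⬝ᵥ ((U * diagonal g * Uᵀ) *ᵥ y p ω) - trace (S p ω * (U * diagonal g * Uᵀ)) :=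
    fun g ω => by
      rw [dotProduct_conj_diagonal_mulVec, trace_mul_conj_diagonal, ← Finset.sum_sub_distrib]
      exact Finset.sum_congr rfl fun i _ => by ring
  have hbd : ∀ g : Fin p → ℝ, (∀ i, 0 ≤ g i) → (∀ i, g i ≤ 2 * K) →
      P₀ {ω | ε / 2 * p ≤ |∑ i, ((Uᵀ *ᵥ y p ω) i ^ 2 - (Uᵀ * S p ω * U) i i) * g i|} ≤ θ / 2 :=
    fun g hg0 hgK => by
      simp only [key]
      exact hp _ (posSemidef_conj_diagonal U hg0) (matrixSpectralNorm_conj_diagonal_le h1 h2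
        (by positivity) fun i => by rw [abs_of_nonneg (hg0 i)]; exact hgK i)
  have b1 := hbd (fun i => f i + K) (fun i => by linarith [(abs_le.1 (hf i)).1])
    (fun i => by linarith [(abs_le.1 (hf i)).2])
  have b2 := hbd (fun _ => K) (fun _ => hK) (fun _ => by linarith)
  refine (measure_mono ?_).trans ((measure_union_le _ _).trans
    ((add_le_add b1 b2).trans_eq (ENNReal.add_halves θ)))
  intro ω hω
  by_contra hcon
  rw [Set.mem_union, not_or] at hcon
  simp only [Set.mem_ofPred_eq, not_le] at hω hcon
  have e : ∑ i, ((Uᵀ *ᵥ y p ω) i ^ 2 - (Uᵀ * S p ω * U) i i) * f i =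
      ∑ i, ((Uᵀ *ᵥ y p ω) i ^ 2 - (Uᵀ * S p ω * U) i i) * (f i + K) -
      ∑ i, ((Uᵀ *ᵥ y p ω) i ^ 2 - (Uᵀ * S p ω * U) i i) * K := by
    rw [← Finset.sum_sub_distrib]
    exact Finset.sum_congr rfl fun i _ => by ring
  rw [e] at hω
  have := abs_sub (∑ i, ((Uᵀ *ᵥ y p ω) i ^ 2 - (Uᵀ * S p ω * U) i i) * (f i + K))
    (∑ i, ((Uᵀ *ᵥ y p ω) i ^ 2 - (Uᵀ * S p ω * U) i i) * K)
  linarith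

end UniformWLLN

/-! ### Replacing a random column by its covariance -/

section Swap

/-- The exceptional set need not be measurable, so it is replaced by its measurable hull of the same
measure. -/
theorem norm_integral_le_of_norm_le_off {Ω E : Type*} [MeasurableSpace Ω] [NormedAddCommGroup E]
    [NormedSpace ℝ E] {P : Measure Ω} [IsProbabilityMeasure P] {f : Ω → E} {s : Set Ω} {a C θ : ℝ}
    (ha : 0 ≤ a) (hθ : 0 ≤ θ) (hC : ∀ ω, ‖f ω‖ ≤ C) (hs : P s ≤ ENNReal.ofReal θ)
    (hf : ∀ ω ∉ s, ‖f ω‖ ≤ a) : ‖∫ ω, f ω ∂P‖ ≤ a + C * θ := by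
  obtain ⟨ω₀⟩ := P.nonempty_of_neZero
  have hC0 : 0 ≤ C := (norm_nonneg _).trans (hC ω₀)
  set t := toMeasurable P s with ht
  have htm : MeasurableSet t := measurableSet_toMeasurable P s
  have hint : Integrable (fun ω => a + t.indicator (fun _ => C) ω) P :=
    (integrable_const a).add ((integrable_const C).indicator htm)
  refine (norm_integral_le_of_norm_le hint (Eventually.of_forall fun ω => ?_)).trans ?_
  · by_cases hω : ω ∈ t
    · simpa [hω] using (hC ω).trans (by linarith)
    · simpa [hω] using hf ω fun h => hω (subset_toMeasurable P s h)
  · rw [integral_add (integrable_const a) ((integrable_const C).indicator htm),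
      integral_indicator_const _ htm]
    simp only [integral_const, probReal_univ, smul_eq_mul, one_mul]
    have : P.real t ≤ θ := by
      rw [measureReal_def, ht, measure_toMeasurable]
      exact ENNReal.toReal_le_of_le_ofReal hθ hs
    rw [mul_comm C]
    gcongr

theorem measurable_rankOneShift {p : ℕ} (l : Fin p → ℝ) (z : ℂ) :
    Measurable fun q : Fin p → ℝ => rankOneShift l z q := by
  unfold rankOneShift
  fun_prop

/-- The second integral involves `S` but not `y`, so it is the common reference for every vector
obeying the weak law with this `S`. Uniformity in `U`, `l` and `c` is essential, since these come
from the frozen columns. -/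
theorem QuadraticFormWLLN.norm_integral_rankOneShift_sub_le {Ω₀ : Type*} [MeasurableSpace Ω₀]
    {P₀ : Measure Ω₀} [IsProbabilityMeasure P₀] {y : (p : ℕ) → Ω₀ → (Fin p → ℝ)}
    (hy : ∀ p, AEMeasurable (y p) P₀)
    {S : (p : ℕ) → Ω₀ → Matrix (Fin p) (Fin p) ℝ} (hS : ∀ p, Measurable (S p))
    (hSpos : ∀ p ω, (S p ω).PosSemidef) (h : QuadraticFormWLLN P₀ y S)
    {z : ℂ} (hz : 0 < z.im) {C η : ℝ} (hC : 0 ≤ C) (hη : 0 < η) :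
    ∀ᶠ p : ℕ in atTop, ∀ U : Matrix (Fin p) (Fin p) ℝ, U * Uᵀ = 1 → Uᵀ * U = 1 →
      ∀ l : Fin p → ℝ, (∀ i, 0 ≤ l i) → ∀ c : ℝ, 0 ≤ c → c * p ≤ C →
      ‖∫ ω, rankOneShift l z (fun i => c * (Uᵀ *ᵥ y p ω) i ^ 2) ∂P₀ -
        ∫ ω, rankOneShift l z (fun i => c * (Uᵀ * S p ω * U) i i) ∂P₀‖ ≤ η := by
  set v := z.im with hv
  -- `D` is the stability constant of the quotient. `ε` makes the contribution of the good event at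
  -- most `η / 2`, `θ` makes that of the four bad events equal to `η / 2`, and `K` bounds both `|g|`
  -- and `|g|²`.
  set D := ‖z‖ / v * (1 + v⁻¹) with hD
  have hD0 : 0 ≤ D := by positivity
  set ε := η / (4 * D * C + 1) with hεdef
  have hε : 0 < ε := by positivity
  set θ := η * v / 16 with hθdef
  have hθ : 0 < θ := by positivity
  set K := v⁻¹ + v⁻¹ ^ 2 with hK
  filter_upwards [h.uniform_diagonal K (by positivity) hε (ENNReal.ofReal_pos.2 hθ)]
    with p hp U h1 h2 l hl c hc hcC
  set g : Fin p → ℂ := fun i => ((l i : ℂ) - z)⁻¹ with hg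
  have hgn : ∀ i, ‖g i‖ ≤ v⁻¹ := fun i => norm_inv_sub_le (l i) hz
  have hgK : ∀ i, ‖g i‖ ≤ K := fun i => (hgn i).trans (le_add_of_nonneg_right (by positivity))
  have hg2K : ∀ i, ‖g i ^ 2‖ ≤ K := fun i => by
    rw [norm_pow]
    exact (pow_le_pow_left₀ (norm_nonneg _) (hgn i) 2).trans
      (le_add_of_nonneg_left (by positivity))
  set d : Ω₀ → Fin p → ℝ := fun ω i => (Uᵀ *ᵥ y p ω) i ^ 2 - (Uᵀ * S p ω * U) i i with hd
  set bad : (Fin p → ℝ) → Set Ω₀ := fun f => {ω | ε * p ≤ |∑ i, d ω i * f i|} with hbad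
  have hb : ∀ f : Fin p → ℝ, (∀ i, |f i| ≤ K) → P₀ (bad f) ≤ ENNReal.ofReal θ :=
    fun f hf => hp U h1 h2 f hf
  -- The weak law has real weights, so the statistics for `g` and `g²` are split into real and
  -- imaginary parts.
  set s := (bad (fun i => (g i).re) ∪ bad (fun i => (g i).im)) ∪
    (bad (fun i => (g i ^ 2).re) ∪ bad (fun i => (g i ^ 2).im)) with hs
  have hsP : P₀ s ≤ ENNReal.ofReal (4 * θ) := by
    refine (measure_union_le _ _).trans ((add_le_add (measure_union_le _ _)
      (measure_union_le _ _)).trans ((add_le_add (add_le_add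
        (hb _ fun i => (Complex.abs_re_le_norm _).trans (hgK i))
        (hb _ fun i => (Complex.abs_im_le_norm _).trans (hgK i))) (add_le_add
        (hb _ fun i => (Complex.abs_re_le_norm _).trans (hg2K i))
        (hb _ fun i => (Complex.abs_im_le_norm _).trans (hg2K i)))).trans_eq ?_))
    rw [← ENNReal.ofReal_add hθ.le hθ.le, ← ENNReal.ofReal_add (by positivity) (by positivity)]
    congr 1; ring
  have hsum : ∀ (f : Fin p → ℂ) ω, ω ∉ bad (fun i => (f i).re) → ω ∉ bad (fun i => (f i).im) →
      ‖∑ i, (d ω i : ℂ) * f i‖ ≤ 2 * (ε * p) := fun f ω hr hi => by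
    simp only [hbad, Set.mem_ofPred_eq, not_le] at hr hi
    refine (Complex.norm_le_abs_re_add_abs_im _).trans ?_
    simp only [Complex.re_sum, Complex.im_sum, Complex.re_ofReal_mul, Complex.im_ofReal_mul]
    linarith
  set q : Ω₀ → Fin p → ℝ := fun ω i => c * (Uᵀ *ᵥ y p ω) i ^ 2 with hq
  set r : Ω₀ → Fin p → ℝ := fun ω i => c * (Uᵀ * S p ω * U) i i with hr
  have hq0 : ∀ ω i, 0 ≤ q ω i := fun ω i => by positivity
  have hr0 : ∀ ω i, 0 ≤ r ω i := fun ω i => by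
    have := ((hSpos p ω).conjTranspose_mul_mul_same U).diag_nonneg (i := i)
    rw [conjTranspose_eq_transpose_of_trivial] at this
    exact mul_nonneg hc this
  have hqm : AEMeasurable (fun ω => rankOneShift l z (q ω)) P₀ := by
    have hm : Measurable fun t : Fin p → ℝ => fun i => c * (Uᵀ *ᵥ t) i ^ 2 :=
      Continuous.measurable (by fun_prop)
    exact ((measurable_rankOneShift l z).comp hm).comp_aemeasurable (hy p)
  have hrm : Measurable (fun ω => rankOneShift l z (r ω)) := by
    have hm : Measurable fun t : Matrix (Fin p) (Fin p) ℝ => fun i => c * (Uᵀ * t * U) i i :=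
      Continuous.measurable (by fun_prop)
    exact ((measurable_rankOneShift l z).comp hm).comp (hS p)
  have hqi : Integrable (fun ω => rankOneShift l z (q ω)) P₀ :=
    Integrable.of_bound hqm.aestronglyMeasurable v⁻¹
      (Eventually.of_forall fun ω => norm_rankOneShift_le hl (hq0 ω) hz)
  have hri : Integrable (fun ω => rankOneShift l z (r ω)) P₀ :=
    Integrable.of_bound hrm.aestronglyMeasurable v⁻¹
      (Eventually.of_forall fun ω => norm_rankOneShift_le hl (hr0 ω) hz)
  rw [← integral_sub hqi hri]
  refine (norm_integral_le_of_norm_le_off (a := D * (2 * (ε * C))) (C := 2 * v⁻¹) (θ := 4 * θ)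
    (s := s) (by positivity) (by positivity) (fun ω => ?_) hsP fun ω hω => ?_).trans ?_
  · refine (norm_sub_le _ _).trans ?_
    have := norm_rankOneShift_le hl (hq0 ω) hz
    have := norm_rankOneShift_le hl (hr0 ω) hz
    linarith
  · refine (norm_rankOneShift_sub_le hl (hq0 ω) (hr0 ω) hz).trans ?_
    simp only [hs, Set.mem_union, not_or] at hω
    have e : ∀ f : Fin p → ℂ, ∑ i, ((q ω i - r ω i : ℝ) : ℂ) * f i =
        c * ∑ i, (d ω i : ℂ) * f i := fun f => by
      rw [Finset.mul_sum]
      refine Finset.sum_congr rfl fun i _ => ?_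
      simp only [hq, hr, hd]
      push_cast; ring
    have hle : ∀ f : Fin p → ℂ, ‖∑ i, (d ω i : ℂ) * f i‖ ≤ 2 * (ε * p) →
        ‖∑ i, ((q ω i - r ω i : ℝ) : ℂ) * f i‖ ≤ 2 * (ε * C) := fun f hf => by
      rw [e, norm_mul, Complex.norm_of_nonneg hc]
      calc c * ‖∑ i, (d ω i : ℂ) * f i‖ ≤ c * (2 * (ε * p)) := by gcongr
        _ = 2 * (ε * (c * p)) := by ring
        _ ≤ _ := by gcongr
    have b1 := hle g (hsum g ω hω.1.1 hω.1.2)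
    have b2 := hle (fun i => g i ^ 2) (hsum (fun i => g i ^ 2) ω hω.2.1 hω.2.2)
    calc ‖z‖ / v * (‖∑ i, ((q ω i - r ω i : ℝ) : ℂ) * g i ^ 2‖ +
          v⁻¹ * ‖∑ i, ((q ω i - r ω i : ℝ) : ℂ) * g i‖)
        ≤ ‖z‖ / v * (2 * (ε * C) + v⁻¹ * (2 * (ε * C))) := by gcongr
      _ = D * (2 * (ε * C)) := by rw [hD]; ring
  · have e1 : D * (2 * (ε * C)) ≤ η / 2 := by
      have : D * (2 * (ε * C)) = η / 2 * (4 * D * C / (4 * D * C + 1)) := by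
        rw [hεdef]; field_simp; ring
      rw [this]
      refine mul_le_of_le_one_right (by positivity) ?_
      rw [div_le_one (by positivity)]
      linarith
    have e2 : 2 * v⁻¹ * (4 * θ) = η / 2 := by
      rw [hθdef]; field_simp; ring
    linarith

end Swap

/-! ### Comparison of the mean Stieltjes transforms -/

section SampleCovariance

theorem posSemidef_sampleCov {p n : ℕ} (X : Matrix (Fin p) (Fin n) ℝ) :
    (sampleCov X).PosSemidef := by
  have := posSemidef_self_mul_conjTranspose X
  rw [conjTranspose_eq_transpose_of_trivial] at this
  exact this.smul (by positivity)

/-- The resolvent trace of the sample covariance matrix as a function of the columns. -/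
noncomputable def stieltjesOfColumns {p n : ℕ} (z : ℂ) (x : Fin n → Fin p → ℝ) : ℂ :=
  stieltjesESD (sampleCov (Matrix.of x)ᵀ) z

/-- Zeroing column `k` produces the leave-one-out matrix, which does not depend on the column being
exchanged. -/
theorem sampleCov_update {p n : ℕ} (x : Fin n → Fin p → ℝ) (k : Fin n) (t : Fin p → ℝ) :
    sampleCov (Matrix.of (Function.update x k t))ᵀ =
      sampleCov (Matrix.of (Function.update x k 0))ᵀ + (n : ℝ)⁻¹ • vecMulVec t t := by
  rw [sampleCov, sampleCov, ← smul_add]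
  congr 1
  ext i j
  simp only [transpose_transpose, Matrix.mul_apply, Matrix.add_apply, transpose_apply, of_apply,
    vecMulVec_apply]
  have : ∀ m, Function.update x k t m i * Function.update x k t m j =
      Function.update x k 0 m i * Function.update x k 0 m j + if m = k then t i * t j else 0 :=
    fun m => by
      by_cases h : m = k
      · subst h; simp
      · simp [h]
  simp [this, Finset.sum_add_distrib]

theorem measurable_stieltjesOfColumns {p n : ℕ} (z : ℂ) :
    Measurable (stieltjesOfColumns z : (Fin n → Fin p → ℝ) → ℂ) := by
  refine (measurable_stieltjesESD z).comp (Continuous.measurable ?_)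
  unfold sampleCov
  have : Continuous fun x : Fin n → Fin p → ℝ => (Matrix.of x)ᵀ :=
    continuous_pi fun i => continuous_pi fun k => by
      simp only [transpose_apply, of_apply]; fun_prop
  exact (this.matrix_mul this.matrix_transpose).const_smul ((n : ℝ)⁻¹)

theorem norm_stieltjesOfColumns_le {p n : ℕ} {z : ℂ} (hz : 0 < z.im) (x : Fin n → Fin p → ℝ) :
    ‖stieltjesOfColumns z x‖ ≤ z.im⁻¹ :=
  norm_stieltjesESD_le (posSemidef_sampleCov _) hz

theorem norm_stieltjesOfColumns_update_sub_le {p n : ℕ} {z : ℂ} (hz : 0 < z.im)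
    (x : Fin n → Fin p → ℝ) (k : Fin n) (s t : Fin p → ℝ) :
    ‖stieltjesOfColumns z (Function.update x k s) - stieltjesOfColumns z (Function.update x k t)‖ ≤
      2 * ((p : ℝ)⁻¹ * z.im⁻¹) := by
  have hB := posSemidef_sampleCov (Matrix.of (Function.update x k 0))ᵀ
  have hn : (0 : ℝ) ≤ (n : ℝ)⁻¹ := by positivity
  have h1 := norm_stieltjesESD_add_sub_le hB hz hn s
  have h2 := norm_stieltjesESD_add_sub_le hB hz hn t
  rw [stieltjesOfColumns, stieltjesOfColumns, sampleCov_update x k s, sampleCov_update x k t,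
    ← sub_sub_sub_cancel_right _ _
      (stieltjesESD (sampleCov (Matrix.of (Function.update x k 0))ᵀ) z), two_mul]
  exact (norm_sub_le _ _).trans (add_le_add h1 h2)

theorem integral_stieltjesOfColumns_update {p n : ℕ} {z : ℂ} (hz : 0 < z.im)
    {Ω₀ : Type*} [MeasurableSpace Ω₀] {P₀ : Measure Ω₀} [IsProbabilityMeasure P₀]
    {y : Ω₀ → Fin p → ℝ} (hy : AEMeasurable y P₀) (x : Fin n → Fin p → ℝ) (k : Fin n)
    {U : Matrix (Fin p) (Fin p) ℝ} (h1 : U * Uᵀ = 1) (h2 : Uᵀ * U = 1) {l : Fin p → ℝ}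
    (hl : ∀ i, 0 ≤ l i)
    (hB : sampleCov (Matrix.of (Function.update x k 0))ᵀ = U * diagonal l * Uᵀ) :
    ∫ t, stieltjesOfColumns z (Function.update x k t) ∂P₀.map y =
      stieltjesESD (U * diagonal l * Uᵀ) z - (p : ℂ)⁻¹ *
        ∫ ω, rankOneShift l z (fun i => (n : ℝ)⁻¹ * (Uᵀ *ᵥ y ω) i ^ 2) ∂P₀ := by
  have hm : Measurable fun t => stieltjesOfColumns z (Function.update x k t) :=
    (measurable_stieltjesOfColumns z).comp (measurable_update x)
  rw [integral_map hy hm.aestronglyMeasurable]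
  have hn : (0 : ℝ) ≤ (n : ℝ)⁻¹ := by positivity
  simp only [stieltjesOfColumns, sampleCov_update x k (y _), hB,
    stieltjesESD_conj_diagonal_add h1 h2 hl hz hn]
  have hqm : AEMeasurable
      (fun ω => rankOneShift l z (fun i => (n : ℝ)⁻¹ * (Uᵀ *ᵥ y ω) i ^ 2)) P₀ := by
    have hm : Measurable fun t : Fin p → ℝ => fun i => (n : ℝ)⁻¹ * (Uᵀ *ᵥ t) i ^ 2 :=
      Continuous.measurable (by fun_prop)
    exact ((measurable_rankOneShift l z).comp hm).comp_aemeasurable hy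
  have hqi : Integrable
      (fun ω => rankOneShift l z (fun i => (n : ℝ)⁻¹ * (Uᵀ *ᵥ y ω) i ^ 2)) P₀ :=
    Integrable.of_bound hqm.aestronglyMeasurable z.im⁻¹
      (Eventually.of_forall fun ω => norm_rankOneShift_le hl (fun i => by positivity) hz)
  rw [integral_sub (integrable_const _) (hqi.const_mul _), integral_const_mul]
  simp

theorem tendsto_integral_stieltjesOfColumns_sub {Ω₀ : Type*} [MeasurableSpace Ω₀]
    {P₀ : Measure Ω₀} [IsProbabilityMeasure P₀] {y x : (p : ℕ) → Ω₀ → (Fin p → ℝ)}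
    (hy : ∀ p, AEMeasurable (y p) P₀) (hx : ∀ p, AEMeasurable (x p) P₀)
    {S : (p : ℕ) → Ω₀ → Matrix (Fin p) (Fin p) ℝ} (hS : ∀ p, Measurable (S p))
    (hSpos : ∀ p ω, (S p ω).PosSemidef) (hyS : QuadraticFormWLLN P₀ y S)
    (hxS : QuadraticFormWLLN P₀ x S) {p : ℕ → ℕ} {c : ℝ} (hc : 0 < c)
    (hp : Tendsto (fun n : ℕ => (p n : ℝ) / (n : ℝ)) atTop (𝓝 c)) {z : ℂ} (hz : 0 < z.im) :
    Tendsto (fun n : ℕ =>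
      ∫ u, stieltjesOfColumns z u ∂Measure.pi (fun _ : Fin n => P₀.map (y (p n))) -
      ∫ u, stieltjesOfColumns z u ∂Measure.pi (fun _ : Fin n => P₀.map (x (p n))))
      atTop (𝓝 0) := by
  have hpinf : Tendsto p atTop atTop := by
    rw [← tendsto_natCast_atTop_iff (R := ℝ)]
    refine (hp.pos_mul_atTop hc tendsto_natCast_atTop_atTop).congr' ?_
    filter_upwards [eventually_gt_atTop 0] with n hn
    have : (n : ℝ) ≠ 0 := by positivity
    field_simp
  rw [tendsto_zero_iff_norm_tendsto_zero, Metric.tendsto_nhds]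
  intro ε hε
  -- Each swap costs at most `2η / p`, and `n / p < 2 / c` eventually, so the total is below `ε /
  -- 2`.
  set η := ε * c / 8 with hη
  have hη0 : 0 < η := by positivity
  have e1 := hpinf.eventually (hyS.norm_integral_rankOneShift_sub_le hy hS hSpos hz
    (C := 2 * c) (by positivity) hη0)
  have e2 := hpinf.eventually (hxS.norm_integral_rankOneShift_sub_le hx hS hSpos hz
    (C := 2 * c) (by positivity) hη0)
  filter_upwards [e1, e2, eventually_gt_atTop 0, hp.eventually (lt_mem_nhds (half_lt_self hc)),
    hp.eventually (gt_mem_nhds (show c < 2 * c by linarith))] with n h1 h2 hn hlo hhi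
  have hn' : (0 : ℝ) < n := by exact_mod_cast hn
  have hpn : (0 : ℝ) < p n := by
    have := (lt_div_iff₀ hn').1 hlo
    exact (by positivity : 0 < c / 2 * n).trans this
  have hYp : IsProbabilityMeasure (P₀.map (y (p n))) := Measure.isProbabilityMeasure_map (hy _)
  have hXp : IsProbabilityMeasure (P₀.map (x (p n))) := Measure.isProbabilityMeasure_map (hx _)
  have key := norm_integral_pi_sub_le (P₀.map (y (p n))) (P₀.map (x (p n)))
    (δ := (p n : ℝ)⁻¹ * (η + η)) n (stieltjesOfColumns z)
    (measurable_stieltjesOfColumns z).stronglyMeasurable (norm_stieltjesOfColumns_le hz)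
    fun k u => by
      obtain ⟨U, l, hU1, hU2, hl, hB⟩ := (posSemidef_sampleCov
        (Matrix.of (Function.update u k 0))ᵀ).exists_orthogonal_diagonalization
      rw [integral_stieltjesOfColumns_update hz (hy _) u k hU1 hU2 hl hB,
        integral_stieltjesOfColumns_update hz (hx _) u k hU1 hU2 hl hB, sub_sub_sub_cancel_left,
        ← mul_sub, norm_mul, norm_inv, Complex.norm_natCast]
      gcongr
      have hcn : (n : ℝ)⁻¹ * p n ≤ 2 * c := by
        rw [mul_comm, ← div_eq_mul_inv]; exact hhi.le
      have b1 := h1 U hU1 hU2 l hl (n : ℝ)⁻¹ (by positivity) hcn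
      have b2 := h2 U hU1 hU2 l hl (n : ℝ)⁻¹ (by positivity) hcn
      -- Insert the reference integral depending on `S` only, which is the same for both vectors.
      rw [← sub_sub_sub_cancel_right _ _
        (∫ ω, rankOneShift l z (fun i => (n : ℝ)⁻¹ * (Uᵀ * S (p n) ω * U) i i) ∂P₀)]
      exact (norm_sub_le _ _).trans (add_le_add b2 b1)
  rw [Real.dist_eq, sub_zero, abs_norm]
  refine key.trans_lt ?_
  have h3 := (lt_div_iff₀ hn').1 hlo
  rw [hη, ← mul_assoc, ← div_eq_mul_inv, div_mul_eq_mul_div, div_lt_iff₀ hpn]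
  nlinarith

end SampleCovariance

/-! ### Almost sure concentration around the mean -/

section Concentration

/-- Borel–Cantelli at the levels `1 / (k + 1)`; it uses no relation between different `n`. -/
theorem ae_tendsto_zero_of_summable {Ω : Type*} [MeasurableSpace Ω] {P : Measure Ω}
    [IsProbabilityMeasure P] {X : ℕ → Ω → ℝ}
    (h : ∀ ε : ℝ, 0 < ε → Summable fun n => P.real {ω | ε ≤ |X n ω|}) :
    ∀ᵐ ω ∂P, Tendsto (fun n => X n ω) atTop (𝓝 0) := by
  have h1 : ∀ k : ℕ, ∀ᵐ ω ∂P, ∀ᶠ n in atTop, ω ∉ {ω | 1 / ((k : ℝ) + 1) ≤ |X n ω|} := fun k => by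
    refine ae_eventually_notMem ?_
    have hs := h (1 / ((k : ℝ) + 1)) (by positivity)
    have e : ∀ n, P {ω | 1 / ((k : ℝ) + 1) ≤ |X n ω|} =
        ENNReal.ofReal (P.real {ω | 1 / ((k : ℝ) + 1) ≤ |X n ω|}) := fun n => by simp
    simp only [e]
    exact hs.tsum_ofReal_ne_top
  filter_upwards [ae_all_iff.2 h1] with ω hω
  rw [Metric.tendsto_nhds]
  intro ε hε
  obtain ⟨k, hk⟩ := exists_nat_one_div_lt hε
  filter_upwards [hω k] with n hn
  rw [Real.dist_eq, sub_zero]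
  exact (not_le.1 hn).trans hk

theorem measureReal_abs_ge_le_of_hasSubgaussianMGF {Ω : Type*} [MeasurableSpace Ω] {μ : Measure Ω}
    [IsFiniteMeasure μ] {X : Ω → ℝ} {c : NNReal} (h : HasSubgaussianMGF X c μ) {ε : ℝ}
    (hε : 0 ≤ ε) : μ.real {ω | ε ≤ |X ω|} ≤ 2 * Real.exp (-ε ^ 2 / (2 * c)) := by
  have h1 := h.measure_ge_le hε
  have h2 := h.neg.measure_ge_le hε
  refine (measureReal_mono (s₂ := {ω | ε ≤ X ω} ∪ {ω | ε ≤ (-X) ω}) ?_).trans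
    ((measureReal_union_le _ _).trans (by linarith))
  intro ω hω
  exact le_abs.1 (id hω : ε ≤ |X ω|)

/-- The bounded differences are of order `1 / p`, so the variance proxy `n b²` is of order `1 / n`
and the tails are geometrically small in `n`. -/
theorem ae_tendsto_stieltjesESD_sub_integral {Ω₀ : Type*} [MeasurableSpace Ω₀]
    {P₀ : Measure Ω₀} [IsProbabilityMeasure P₀] {Ω : Type*} [MeasurableSpace Ω] {P : Measure Ω}
    [IsProbabilityMeasure P] {y : (p : ℕ) → Ω₀ → (Fin p → ℝ)}
    (hy : ∀ p, AEMeasurable (y p) P₀) {p : ℕ → ℕ} {c : ℝ} (hc : 0 < c)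
    (hp : Tendsto (fun n : ℕ => (p n : ℝ) / (n : ℝ)) atTop (𝓝 c))
    {Y : (n : ℕ) → Ω → Matrix (Fin (p n)) (Fin n) ℝ}
    (hY : ∀ n, ColumnsAreIndepCopies (Y n) P (y (p n)) P₀) {z : ℂ} (hz : 0 < z.im) :
    ∀ᵐ ω ∂P, Tendsto (fun n : ℕ => stieltjesESD (sampleCov (Y n ω)) z -
      ∫ u, stieltjesOfColumns z u ∂Measure.pi (fun _ : Fin n => P₀.map (y (p n))))
      atTop (𝓝 0) := by
  set b : ℕ → NNReal := fun n => ⟨2 * ((p n : ℝ)⁻¹ * z.im⁻¹), by positivity⟩ with hb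
  have hYp : ∀ n, IsProbabilityMeasure (P₀.map (y (p n))) :=
    fun n => Measure.isProbabilityMeasure_map (hy _)
  have hYm : ∀ n (k : Fin n), AEMeasurable (fun (ω : Ω) (i : Fin (p n)) => Y n ω i k) P :=
    fun n k => ((hY n).2 k).aemeasurable_fst
  have hlaw : ∀ n, P.map (fun ω k i => Y n ω i k) =
      Measure.pi (fun _ : Fin n => P₀.map (y (p n))) := fun n => by
    rw [(iIndepFun_iff_map_fun_eq_pi_map (hYm n)).1 (hY n).1]
    congr 1
    ext1 k
    exact ((hY n).2 k).map_eq
  have hYae : ∀ n, AEMeasurable (fun ω k i => Y n ω i k) P := fun n =>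
    aemeasurable_pi_lambda _ (hYm n)
  have hsum : ∀ ε : ℝ, 0 < ε →
      Summable fun n : ℕ => 2 * Real.exp (-ε ^ 2 / (2 * ((n * b n ^ 2 : NNReal) : ℝ))) :=
    fun ε hε => by
      -- Bounds `n · (n b²) = 4 n² / (p Im z)²` as soon as `p > c n / 2`.
      set D := 16 * (c ^ 2)⁻¹ * (z.im ^ 2)⁻¹ with hD
      have hD0 : 0 < D := by positivity
      have hgeo : Summable fun n : ℕ => 2 * Real.exp (-ε ^ 2 / (2 * D)) ^ n :=
        (summable_geometric_of_lt_one (Real.exp_pos _).le (Real.exp_lt_one_iff.2 (by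
          rw [neg_div]; exact neg_neg_of_pos (by positivity)))).mul_left 2
      refine Summable.of_norm_bounded_eventually_nat hgeo ?_
      filter_upwards [eventually_gt_atTop 0, hp.eventually (lt_mem_nhds (half_lt_self hc))]
        with n hn hlo
      have hn' : (0 : ℝ) < n := by exact_mod_cast hn
      have h3 := (lt_div_iff₀ hn').1 hlo
      have hpn : (0 : ℝ) < p n := (by positivity : 0 < c / 2 * n).trans h3
      rw [Real.norm_of_nonneg (by positivity), ← Real.exp_nat_mul]
      gcongr
      have hbn : ((n * b n ^ 2 : NNReal) : ℝ) = n * (2 * ((p n : ℝ)⁻¹ * z.im⁻¹)) ^ 2 := rfl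
      rw [hbn, neg_div, neg_div, mul_neg, neg_le_neg_iff, mul_div_assoc',
        div_le_div_iff₀ (by positivity) (by positivity), hD]
      have h4 : (c / 2 * n) ^ 2 ≤ (p n : ℝ) ^ 2 := pow_le_pow_left₀ (by positivity) h3.le 2
      have h5 : n * (2 * ((p n : ℝ)⁻¹ * z.im⁻¹)) ^ 2 * n ≤ 16 * (c ^ 2)⁻¹ * (z.im ^ 2)⁻¹ := by
        calc n * (2 * ((p n : ℝ)⁻¹ * z.im⁻¹)) ^ 2 * n
            = 4 * n ^ 2 * (z.im ^ 2)⁻¹ * ((p n : ℝ) ^ 2)⁻¹ := by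
              rw [mul_pow, mul_pow, inv_pow, inv_pow]; ring
          _ ≤ 4 * n ^ 2 * (z.im ^ 2)⁻¹ * ((c / 2 * n) ^ 2)⁻¹ := by gcongr
          _ = _ := by field_simp; ring
      calc (n : ℝ) * ε ^ 2 * (2 * (n * (2 * ((p n : ℝ)⁻¹ * z.im⁻¹)) ^ 2))
          = ε ^ 2 * (2 * (n * (2 * ((p n : ℝ)⁻¹ * z.im⁻¹)) ^ 2 * n)) := by ring
        _ ≤ _ := by gcongr
  -- McDiarmid is for real functions; `L` stands for the real and the imaginary part.
  have part : ∀ L : ℂ →L[ℝ] ℝ, (∀ x, |L x| ≤ ‖x‖) → ∀ᵐ ω ∂P, Tendsto (fun n : ℕ =>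
      L (stieltjesESD (sampleCov (Y n ω)) z -
        ∫ u, stieltjesOfColumns z u ∂Measure.pi (fun _ : Fin n => P₀.map (y (p n)))))
      atTop (𝓝 0) := fun L hL => by
    refine ae_tendsto_zero_of_summable fun ε hε => ?_
    refine (hsum ε hε).of_nonneg_of_le (fun n => measureReal_nonneg) fun n => ?_
    have hmeas : Measurable fun u : Fin n → Fin (p n) → ℝ => L (stieltjesOfColumns z u) :=
      L.continuous.measurable.comp (measurable_stieltjesOfColumns z)
    have hsub := hasSubgaussianMGF_pi_of_bounded_differences (P₀.map (y (p n))) (c := b n) n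
      (fun u : Fin n → Fin (p n) → ℝ => L (stieltjesOfColumns z u)) hmeas
      (fun u => (hL _).trans (norm_stieltjesOfColumns_le hz u)) fun k u s t => by
        rw [← map_sub]
        exact (hL _).trans (norm_stieltjesOfColumns_update_sub_le hz u k s t)
    have hint : Integrable (stieltjesOfColumns z)
        (Measure.pi fun _ : Fin n => P₀.map (y (p n))) :=
      integrable_of_bounded (measurable_stieltjesOfColumns z).stronglyMeasurable
        (norm_stieltjesOfColumns_le hz)
    rw [L.integral_comp_comm hint] at hsub
    have h1 := measureReal_abs_ge_le_of_hasSubgaussianMGF hsub hε.le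
    rw [← hlaw, measureReal_def, Measure.map_apply_of_aemeasurable (hYae n)
      (measurableSet_le measurable_const (hmeas.sub_const _).abs), hlaw] at h1
    simp only [map_sub]
    exact h1
  filter_upwards [part Complex.reCLM Complex.abs_re_le_norm,
    part Complex.imCLM Complex.abs_im_le_norm] with ω hre him
  rw [tendsto_zero_iff_norm_tendsto_zero]
  refine squeeze_zero (fun _ => norm_nonneg _) (fun n => Complex.norm_le_abs_re_add_abs_im _) ?_
  simpa using hre.abs.add him.abs

end Concentration

theorem mainTheorem1
    {Ω₀ : Type*} [MeasurableSpace Ω₀] (P₀ : Measure Ω₀) [IsProbabilityMeasure P₀]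
    {Ω : Type*} [MeasurableSpace Ω] (P : Measure Ω) [IsProbabilityMeasure P]
    -- the random vectors `yₚ` and the random positive semi-definite matrices `Σₚ`
    (y : (p : ℕ) → Ω₀ → (Fin p → ℝ)) (hy : ∀ p, Measurable (y p))
    (S : (p : ℕ) → Ω₀ → Matrix (Fin p) (Fin p) ℝ) (hS : ∀ p, Measurable (S p))
    (hSpos : ∀ p ω, (S p ω).PosSemidef)
    -- standard normal vectors `wₚ`, each independent of `Σₚ`
    (w : (p : ℕ) → Ω₀ → (Fin p → ℝ))
    (hw : ∀ p, HasLaw (w p) (Measure.pi fun _ : Fin p => gaussianReal 0 1) P₀)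
    (hwS : ∀ p, IndepFun (w p) (S p) P₀)
    (hA1 : QuadraticFormWLLN P₀ y S)
    (hA2 : TraceSqNegligible P₀ S)
    -- the dimension `p = p(n)`
    (p : ℕ → ℕ) (c : ℝ) (hc : 0 < c)
    (hp : Tendsto (fun n : ℕ => (p n : ℝ) / (n : ℝ)) atTop (𝓝 c))
    -- columns of `Y n`: independent copies of `yₚ`; of `Z n`: of `Σₚ^{1/2} wₚ`
    (Y Z : (n : ℕ) → Ω → Matrix (Fin (p n)) (Fin n) ℝ)
    (hY : ∀ n, ColumnsAreIndepCopies (Y n) P (y (p n)) P₀)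
    (hZ : ∀ n, ColumnsAreIndepCopies (Z n) P
      (fun ω => CFC.sqrt (S (p n) ω) *ᵥ w (p n) ω) P₀) :
    ∀ z : ℂ, 0 < z.im →
      ∀ᵐ ω ∂P, Tendsto
        (fun n : ℕ => stieltjesESD (sampleCov (Y n ω)) z - stieltjesESD (sampleCov (Z n ω)) z)
        atTop (𝓝 0) := by
  intro z hz
  have hzm : ∀ q, AEMeasurable (fun ω => CFC.sqrt (S q ω) *ᵥ w q ω) P₀ := fun q => by
    have hsq : ∀ ω, CFC.sqrt (S q ω) = psdSqrt (S q ω) := fun ω => by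
      simp [psdSqrt, hSpos q ω]
    have hc : Continuous fun x : Matrix (Fin q) (Fin q) ℝ × (Fin q → ℝ) => x.1 *ᵥ x.2 := by
      fun_prop
    simp only [hsq]
    exact hc.measurable.comp_aemeasurable
      (((measurable_psdSqrt q).comp (hS q)).aemeasurable.prodMk (hw q).aemeasurable)
  have hym : ∀ q, AEMeasurable (y q) P₀ := fun q => (hy q).aemeasurable
  have hE := tendsto_integral_stieltjesOfColumns_sub hym hzm hS hSpos hA1
    (quadraticFormWLLN_gaussian_mixture hS hSpos hw hwS hA2) hc hp hz
  filter_upwards [ae_tendsto_stieltjesESD_sub_integral hym hc hp hY hz,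
    ae_tendsto_stieltjesESD_sub_integral hzm hc hp hZ hz] with ω h1 h2
  have h := (h1.sub h2).add hE
  rw [sub_zero, add_zero] at h
  refine h.congr fun n => ?_
  ring
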